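/- Let $h\in(0,1)$, $Y=(0,1)$, $Y_0=(0,h)$, $Y_1=(h,1)$. Let $a_0$ on $Y_0$, $a_1$ on $Y_1$ and $\rho$ on $Y$ be real functions, positive almost everywhere, with $a_0,a_0^{-1}\in L^\infty(Y_0)$, $a_1,a_1^{-1}\in L^\infty(Y_1)$, $\rho,\rho^{-1}\in L^\infty(Y)$. Extend $a_0$ and $a_1$ by zero to $Y$. For $\theta\in[0,2\pi)$ let $H^1_\theta(Y)$ be the space of complex-valued $u\in H^1(Y)$ that are $\theta$-quasiperiodic, i.e. $u(y)=e^{\mathrm i\theta y}v(y)$ on $Y$ with $v$ continuous and $1$-periodic, with the norm $$|||u|||=\Bigl(\int_{Y_0}a_0|u'|^2+\int_{Y_1}a_1|u'|^2+\int_Y\rho|u|^2\Bigr)^{1/2}.$$ Let $V_\theta=\{v\in H^1_\theta(Y): v'=0\text{ a.e. on }Y_1\}$, let $V_\theta^\perp$ be its orthogonal complement in $H^1_\theta(Y)$ for the inner product associated with $|||\cdot|||$, and let $P_\theta^\perp$ be the orthogonal projection onto $V_\theta^\perp$. Write $\|f\|_{L^2_\rho(Y)}=(\int_Y\rho|f|^2)^{1/2}$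 for $f\in L^2_\rho(Y)=L^2(Y)$. There is a constant $C_P>0$, independent of $\theta\in[0,2\pi)$, such that $$|||P_\theta^\perp u|||\le C_P\,\|\sqrt{a_1}\,u'\|_{L^2(Y_1)}\qquad\text{for all }\theta\in[0,2\pi),\ u\in H^1_\theta(Y), \tag{1}$$ and for all $\theta\in[0,2\pi)$ and $f\in L^2_\rho(Y)$ the following hold. (a) There is a unique $u^{(0)}_\theta\in V_\theta$ with $$\int_{Y_0}a_0(u^{(0)}_\theta)'\overline{\varphi'}+\int_Y\rho u^{(0)}_\theta\overline\varphi=\int_Y\rho f\overline\varphi\qquad\text{for all }\varphi\in V_\theta.$$ (b) For every integer $n\ge1$ there is, given $u^{(2(n-1))}_\theta$, a unique $u^{(2n)}_\theta\in V_\theta^\perp$ which solves $-(a_1(u^{(2n)}_\theta)')'=(a_0(u^{(2(n-1))}_\theta)')'-\rho u^{(2(n-1))}_\theta+\delta_{1n}\rho f$, in the sense that $$\int_{Y_1}a_1(u^{(2n)}_\theta)'\overline{\varphi'}=-\int_{Y_0}a_0(u^{(2(n-1))}_\theta)'\overline{\varphi'}-\int_Y\rho u^{(2(n-1))}_\theta\overline\varphi+\delta_{1n}\int_Y\rho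 f\overline\varphi\qquad\text{for all }\varphi\in H^1_\theta(Y).$$ (c) For every $\varepsilon\in(0,1)$ there is a unique weak solution $u^\varepsilon_\theta\in H^1_\theta(Y)$ of the resolvent problem $-((\varepsilon^{-2}a_1+a_0)(u^\varepsilon_\theta)')'+\rho u^\varepsilon_\theta=\rho f$, i.e. $$\int_{Y_0}a_0(u^\varepsilon_\theta)'\overline{\varphi'}+\varepsilon^{-2}\int_{Y_1}a_1(u^\varepsilon_\theta)'\overline{\varphi'}+\int_Y\rho u^\varepsilon_\theta\overline\varphi=\int_Y\rho f\overline\varphi\qquad\text{for all }\varphi\in H^1_\theta(Y),$$ and for every constant $C_P>0$ that satisfies (1) and every integer $N\ge0$ $$\Bigl|\Bigl|\Bigl|u^\varepsilon_\theta-\sum_{n=0}^N\varepsilon^{2n}u^{(2n)}_\theta\Bigr|\Bigr|\Bigr|\le C_P^{2(N+1)}\varepsilon^{2(N+1)}\|f\|_{L^2_\rho(Y)}.$$ -/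

import Mathlib

open MeasureTheory Set
open scoped ContDiff

noncomputable section

namespace HighContrast

/-- A real function `w` is an admissible coefficient on `S`: it is positive almost everywhere
on `S`, and both `w` and `1 / w` belong to `L^∞(S)`. -/
structure AdmissibleOn (w : ℝ → ℝ) (S : Set ℝ) : Prop where
  pos : ∀ᵐ y ∂(volume.restrict S), 0 < w y
  memLp : MemLp w ⊤ (volume.restrict S)
  inv_memLp : MemLp (fun y => (w y)⁻¹) ⊤ (volume.restrict S)

/-- The data of the two-phase periodicity cell `Y = (0,1)`: the soft phase is `Y₀ = (0,h)`, the
stiff phase is `Y₁ = (h,1)`, with coefficients `a₀` on `Y₀`, `a₁` on `Y₁`, and a density `ρ` on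
`Y`. (Values of `a₀` outside `Y₀`, and of `a₁` outside `Y₁`, are never used.) -/
structure Cell where
  h : ℝ
  a₀ : ℝ → ℝ
  a₁ : ℝ → ℝ
  ρ : ℝ → ℝ
  h_pos : 0 < h
  h_lt_one : h < 1
  adm_a₀ : AdmissibleOn a₀ (Ioo 0 h)
  adm_a₁ : AdmissibleOn a₁ (Ioo h 1)
  adm_ρ : AdmissibleOn ρ (Ioo 0 1)

/-- Complex `L²(Y)`, `Y = (0,1)`. As a set it coincides with the weighted space `L²_ρ(Y)`, whose
norm is `Cell.normρ` below. -/
abbrev L2Y : Type := Lp ℂ 2 (volume.restrict (Ioo (0 : ℝ) 1))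

/-- `g` is the weak derivative of `u` on `Y = (0,1)`. -/
def HasWeakDeriv (u g : L2Y) : Prop :=
  ∀ φ : ℝ → ℝ, ContDiff ℝ ∞ φ → HasCompactSupport φ → tsupport φ ⊆ Ioo 0 1 →
    (∫ y in Ioo (0 : ℝ) 1, u y * ((deriv φ y : ℝ) : ℂ)) =
      -(∫ y in Ioo (0 : ℝ) 1, g y * ((φ y : ℝ) : ℂ))

/-- `u` is `θ`-quasiperiodic: `u(y) = exp(iθy) v(y)` on `Y` for a continuous `1`-periodic `v`.
For `u ∈ H¹(Y)` this is quasiperiodicity of the continuous representative of `u`. -/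
def IsQuasiperiodic (θ : ℝ) (u : L2Y) : Prop :=
  ∃ v : ℝ → ℂ, Continuous v ∧ Function.Periodic v 1 ∧
    ∀ᵐ y ∂(volume.restrict (Ioo (0 : ℝ) 1)), u y = Complex.exp (Complex.I * θ * y) * v y

theorem integrable_mul_of_continuous (u : L2Y) {ψ : ℝ → ℝ} (hψ : Continuous ψ)
    (hc : HasCompactSupport ψ) :
    Integrable (fun y => u y * ((ψ y : ℝ) : ℂ)) (volume.restrict (Ioo (0 : ℝ) 1)) := by
  obtain ⟨C, hC⟩ := hc.exists_bound_of_continuous hψ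
  have hu : Integrable (fun y => u y) (volume.restrict (Ioo (0 : ℝ) 1)) :=
    (Lp.memLp u).integrable (by norm_num)
  refine hu.mul_bdd (c := C) ?_ ?_
  · exact (Complex.continuous_ofReal.comp hψ).aestronglyMeasurable
  · exact Filter.Eventually.of_forall fun y => by simpa using hC y

theorem HasWeakDeriv.zero : HasWeakDeriv 0 0 := by
  intro φ _ _ _
  have h0 : ∀ ψ : ℝ → ℂ, ∫ y in Ioo (0 : ℝ) 1, (0 : L2Y) y * ψ y = 0 := by
    intro ψ
    refine integral_eq_zero_of_ae ?_
    filter_upwards [Lp.coeFn_zero ℂ 2 (volume.restrict (Ioo (0 : ℝ) 1))] with y hy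
    rw [hy]; simp
  rw [h0, h0, neg_zero]

theorem HasWeakDeriv.add {u g v k : L2Y} (hu : HasWeakDeriv u g) (hv : HasWeakDeriv v k) :
    HasWeakDeriv (u + v) (g + k) := by
  intro φ hφ hc hs
  have key : ∀ (x z : L2Y) (ψ : ℝ → ℝ), Continuous ψ → HasCompactSupport ψ →
      ∫ y in Ioo (0 : ℝ) 1, (x + z : L2Y) y * ((ψ y : ℝ) : ℂ) =
        (∫ y in Ioo (0 : ℝ) 1, x y * ((ψ y : ℝ) : ℂ)) +
          (∫ y in Ioo (0 : ℝ) 1, z y * ((ψ y : ℝ) : ℂ)) := by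
    intro x z ψ h1 h2
    rw [← integral_add (integrable_mul_of_continuous x h1 h2)
      (integrable_mul_of_continuous z h1 h2)]
    refine integral_congr_ae ?_
    filter_upwards [Lp.coeFn_add x z] with y hy
    rw [hy]; simp [add_mul]
  rw [key u v (deriv φ) (hφ.continuous_deriv (by simp)) hc.deriv, key g k φ hφ.continuous hc,
    hu φ hφ hc hs, hv φ hφ hc hs]
  ring

theorem HasWeakDeriv.smul {u g : L2Y} (c : ℂ) (hu : HasWeakDeriv u g) :
    HasWeakDeriv (c • u) (c • g) := by
  intro φ hφ hc hs
  have key : ∀ (x : L2Y) (ψ : ℝ → ℝ),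
      ∫ y in Ioo (0 : ℝ) 1, (c • x : L2Y) y * ((ψ y : ℝ) : ℂ) =
        c * ∫ y in Ioo (0 : ℝ) 1, x y * ((ψ y : ℝ) : ℂ) := by
    intro x ψ
    rw [← integral_const_mul]
    refine integral_congr_ae ?_
    filter_upwards [Lp.coeFn_smul c x] with y hy
    rw [hy]; simp [mul_assoc]
  rw [key u (deriv φ), key g φ, hu φ hφ hc hs]
  ring

theorem IsQuasiperiodic.zero (θ : ℝ) : IsQuasiperiodic θ 0 := by
  refine ⟨0, continuous_zero, fun _ => rfl, ?_⟩
  filter_upwards [Lp.coeFn_zero ℂ 2 (volume.restrict (Ioo (0 : ℝ) 1))] with y hy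
  rw [hy]; simp

theorem IsQuasiperiodic.add {θ : ℝ} {u z : L2Y} (hu : IsQuasiperiodic θ u)
    (hz : IsQuasiperiodic θ z) : IsQuasiperiodic θ (u + z) := by
  obtain ⟨v, hv, hvp, hpv⟩ := hu
  obtain ⟨w, hw, hwp, hqw⟩ := hz
  refine ⟨v + w, hv.add hw, hvp.add hwp, ?_⟩
  filter_upwards [hpv, hqw, Lp.coeFn_add u z] with y h1 h2 h3
  rw [h3]; simp [h1, h2, mul_add]

theorem IsQuasiperiodic.smul {θ : ℝ} {u : L2Y} (c : ℂ) (hu : IsQuasiperiodic θ u) :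
    IsQuasiperiodic θ (c • u) := by
  obtain ⟨v, hv, hvp, hpv⟩ := hu
  refine ⟨c • v, hv.const_smul c, fun y => ?_, ?_⟩
  · simp [hvp y]
  · filter_upwards [hpv, Lp.coeFn_smul c u] with y h1 h2
    simp only [h2, Pi.smul_apply, h1, smul_eq_mul]
    ring

/-- The space `H¹_θ(Y)` of `θ`-quasiperiodic `H¹(Y)` functions, realised as the space of pairs
`(u, u')` of a function and its weak derivative. -/
def H1 (θ : ℝ) : Submodule ℂ (L2Y × L2Y) where
  carrier := {p | HasWeakDeriv p.1 p.2 ∧ IsQuasiperiodic θ p.1}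
  zero_mem' := ⟨HasWeakDeriv.zero, IsQuasiperiodic.zero θ⟩
  add_mem' hp hq := ⟨hp.1.add hq.1, hp.2.add hq.2⟩
  smul_mem' c _ hp := ⟨hp.1.smul c, hp.2.smul c⟩

variable {θ : ℝ}

/-- The function `u` underlying an element of `H¹_θ(Y)`. -/
def fn (u : H1 θ) : L2Y := u.1.1

/-- The weak derivative `u'` of an element of `H¹_θ(Y)`. -/
def der (u : H1 θ) : L2Y := u.1.2

namespace Cell

variable (K : Cell)

/-- `(u, v) ↦ ∫_Y ρ u v̄`. -/
def innerρ (u v : L2Y) : ℂ :=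
  ∫ y in Ioo (0 : ℝ) 1, (K.ρ y : ℂ) * u y * (starRingEnd ℂ) (v y)

/-- `(u, v) ↦ ∫_{Y₀} a₀ u' v̄'`. -/
def soft (u v : H1 θ) : ℂ :=
  ∫ y in Ioo (0 : ℝ) K.h, (K.a₀ y : ℂ) * der u y * (starRingEnd ℂ) (der v y)

/-- `(u, v) ↦ ∫_{Y₁} a₁ u' v̄'`. -/
def stiff (u v : H1 θ) : ℂ :=
  ∫ y in Ioo K.h (1 : ℝ), (K.a₁ y : ℂ) * der u y * (starRingEnd ℂ) (der v y)

/-- The norm of `L²_ρ(Y)`. -/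
def normρ (f : L2Y) : ℝ :=
  Real.sqrt (∫ y in Ioo (0 : ℝ) 1, K.ρ y * ‖f y‖ ^ 2)

/-- `‖√a₁ u'‖_{L²(Y₁)}`. -/
def stiffNorm (u : H1 θ) : ℝ :=
  Real.sqrt (∫ y in Ioo K.h (1 : ℝ), K.a₁ y * ‖der u y‖ ^ 2)

/-- The graph norm `|||u|||` of `H¹_θ(Y)`. -/
def graphNorm (u : H1 θ) : ℝ :=
  Real.sqrt ((∫ y in Ioo (0 : ℝ) K.h, K.a₀ y * ‖der u y‖ ^ 2)
    + (∫ y in Ioo K.h (1 : ℝ), K.a₁ y * ‖der u y‖ ^ 2)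
    + (∫ y in Ioo (0 : ℝ) 1, K.ρ y * ‖fn u y‖ ^ 2))

/-- The inner product of `H¹_θ(Y)` associated with the graph norm. -/
def graphInner (u v : H1 θ) : ℂ :=
  K.soft u v + K.stiff u v + K.innerρ (fn u) (fn v)

/-- The space `V_θ` of those `u ∈ H¹_θ(Y)` with `u' = 0` on `Y₁`. -/
def V (θ : ℝ) : Set (H1 θ) :=
  {u | ∀ᵐ y ∂(volume.restrict (Ioo K.h (1 : ℝ))), der u y = 0}

/-- The orthogonal complement of `V_θ` in `H¹_θ(Y)` for the graph inner product. -/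
def Vperp (θ : ℝ) : Set (H1 θ) :=
  {u | ∀ v ∈ K.V θ, K.graphInner u v = 0}

/-- `w` is the orthogonal projection of `u` onto `V_θ^⊥`. -/
def IsPerpProjection (u w : H1 θ) : Prop :=
  w ∈ K.Vperp θ ∧ u - w ∈ K.V θ

/-- `C` is a constant for which the Poincaré-type inequality
`|||P_θ^⊥ u||| ≤ C ‖√a₁ u'‖_{L²(Y₁)}` holds for all `u ∈ H¹_θ(Y)`, uniformly in `θ`. -/
def IsPoincareConstant (C : ℝ) : Prop :=
  0 < C ∧ ∀ θ ∈ Ico 0 (2 * Real.pi), ∀ u : H1 θ,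
    ∃ w : H1 θ, K.IsPerpProjection u w ∧ K.graphNorm w ≤ C * K.stiffNorm u

/-- `u ∈ H¹_θ(Y)` is the (weak) solution of the resolvent problem
`-((ε⁻² a₁ + a₀) u')' + ρ u = ρ f` of the operator `A^ε_θ`. -/
def IsResolventSolution (ε : ℝ) (f : L2Y) (u : H1 θ) : Prop :=
  ∀ φ : H1 θ, K.soft u φ + ((ε ^ 2)⁻¹ : ℝ) * K.stiff u φ + K.innerρ (fn u) (fn φ)
    = K.innerρ f (fn φ)

/-- `u ∈ V_θ` solves the limit resolvent problem. -/
def IsLimitSolution (f : L2Y) (u : H1 θ) : Prop :=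
  u ∈ K.V θ ∧ ∀ φ ∈ K.V θ, K.soft u φ + K.innerρ (fn u) (fn φ) = K.innerρ f (fn φ)

/-- `w ∈ V_θ^⊥` is the (weak) solution of the `n`-th degenerate problem
`-(a₁ w')' = (a₀ u')' - ρ u + δ_{1n} ρ f`, where `u` is the previous term of the expansion. -/
def IsCorrector (f : L2Y) (n : ℕ) (u w : H1 θ) : Prop :=
  w ∈ K.Vperp θ ∧ ∀ φ : H1 θ, K.stiff w φ
    = - K.soft u φ - K.innerρ (fn u) (fn φ) + (if n = 1 then 1 else 0) * K.innerρ f (fn φ)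

end Cell

/-- `u` is the one and only object with the property `P`. -/
def IsUnique {α : Type*} (P : α → Prop) (u : α) : Prop :=
  P u ∧ ∀ w, P w → w = u

end HighContrast

end

/-! ### Positive contractions on a complex Hilbert space -/

/-! Give `H1 θ` the graph inner product. The stiff form is bounded by the graph norm, so Riesz
representation gives a symmetric operator `A` with `0 ≤ A ≤ 1` (`stiffOp`), and `1 - A` represents
the remaining soft and density terms. Then `V` is the kernel of `A`, and `f` is represented by some
`F` with `‖F‖ ≤ ‖f‖_ρ`. The three weak problems become `A u₀ = 0` with `F - u₀ ⊥ ker A`; `A uₙ₊₁ =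
δₙ₀ F - (1 - A) uₙ` with `uₙ₊₁ ⊥ ker A`; and `(1 - A) u + ε⁻² A u = F`.

The Poincaré inequality says `‖w‖² ≤ C² ⟪A w, w⟫` on `(ker A)ᗮ`. It makes `A` invertible there and
costs a factor `C²` per corrector, since `1 - A` is a contraction (`norm_expansion_le`). The
remainder `r` after `N` terms telescopes to `(ε² (1 - A) + A) r = A (ε^(2N+2) u_{N+1})`. Since `λ /
(ε² (1 - λ) + λ) ≤ 1` on `[0, 1]`, the remainder is no larger than the first omitted term
(`norm_le_of_resolvent`), so no constant beyond `C^(2N+2)` appears.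

Uniformity in `θ` comes from a competitor (`exists_sub_mem_V`): keep `u'` on the stiff phase, put on
the soft phase the constant that makes the mean zero, and integrate. The primitive vanishes at both
ends, so it is quasiperiodic for every `θ`; the projection onto `V_θ^⊥` has minimal norm in the
coset `u + V_θ`. -/

namespace HighContrast

section Hilbert

open scoped InnerProductSpace

variable {E : Type*} [NormedAddCommGroup E] [InnerProductSpace ℂ E]

/-- `A` is a symmetric operator with `0 ≤ A ≤ 1`. -/
structure IsPositiveContraction (A : E →L[ℂ] E) : Prop where
  symm : ∀ x y, ⟪A x, y⟫_ℂ = ⟪x, A y⟫_ℂ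
  nonneg : ∀ x, 0 ≤ (⟪A x, x⟫_ℂ).re
  le_one : ∀ x, (⟪A x, x⟫_ℂ).re ≤ ‖x‖ ^ 2

theorem re_inner_self (x : E) : (⟪x, x⟫_ℂ).re = ‖x‖ ^ 2 := by
  simpa using inner_self_eq_norm_sq (𝕜 := ℂ) x

/-- A coercive operator is surjective. -/
theorem surjective_of_coercive [CompleteSpace E] {L : E →L[ℂ] E} {c : ℝ} (hc : 0 < c)
    (h : ∀ x, c * ‖x‖ ^ 2 ≤ (⟪L x, x⟫_ℂ).re) : Function.Surjective L := by
  have hb : ∀ x, ‖x‖ ≤ c⁻¹ * ‖L x‖ := by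
    intro x
    rcases eq_or_ne ‖x‖ 0 with h0 | h0
    · rw [h0]; positivity
    · have h1 : c * ‖x‖ ^ 2 ≤ ‖L x‖ * ‖x‖ :=
        (h x).trans (re_inner_le_norm (𝕜 := ℂ) _ _)
      have h2 : 0 < ‖x‖ := lt_of_le_of_ne (norm_nonneg _) (Ne.symm h0)
      have h3 : c * ‖x‖ ≤ ‖L x‖ := by nlinarith
      rw [inv_mul_eq_div, le_div_iff₀ hc]
      linarith
  have hanti : AntilipschitzWith ⟨c⁻¹, by positivity⟩ L :=
    L.antilipschitz_of_bound hb
  have hcl : IsClosed (L.range : Set E) := hanti.isClosed_range L.uniformContinuous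
  have : CompleteSpace L.range := hcl.completeSpace_coe
  have horth : L.rangeᗮ = ⊥ := by
    rw [Submodule.eq_bot_iff]
    intro x hx
    have h1 : ⟪L x, x⟫_ℂ = 0 := hx (L x) ⟨x, rfl⟩
    have h2 := h x
    rw [h1] at h2
    have h3 : ‖x‖ ^ 2 ≤ 0 := by
      by_contra hcon
      push Not at hcon
      have := mul_pos hc hcon
      simp at h2
      linarith
    have : ‖x‖ = 0 := by nlinarith [norm_nonneg x]
    exact norm_eq_zero.1 this
  have htop : L.range = ⊤ := by rwa [Submodule.orthogonal_eq_bot_iff] at horth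
  intro y
  have : y ∈ L.range := htop ▸ Submodule.mem_top
  exact this

namespace IsPositiveContraction

variable {A : E →L[ℂ] E}

/-- The operator form of `λ - λ² = λ (1 - λ)² + λ² (1 - λ)`: positivity is tested at `x - A x` and
the upper bound at `A x`, which avoids square roots and spectral theory. -/
theorem norm_sq_le (hA : IsPositiveContraction A) (x : E) :
    ‖A x‖ ^ 2 ≤ (⟪A x, x⟫_ℂ).re := by
  have h1 := hA.nonneg (x - A x)
  have h2 := hA.le_one (A x)
  have h3 : ⟪A (A x), x⟫_ℂ = ⟪A x, A x⟫_ℂ := hA.symm _ _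
  rw [map_sub, inner_sub_left, inner_sub_right, inner_sub_right, h3] at h1
  simp only [Complex.sub_re, re_inner_self] at h1
  linarith

theorem one_sub (hA : IsPositiveContraction A) : IsPositiveContraction (1 - A) where
  symm x y := by
    simp only [sub_apply, one_apply_eq_self, inner_sub_left, inner_sub_right, hA.symm]
  nonneg x := by
    have := hA.le_one x
    simp only [sub_apply, one_apply_eq_self, inner_sub_left,
      Complex.sub_re, re_inner_self]
    linarith
  le_one x := by
    have := hA.nonneg x
    simp only [sub_apply, one_apply_eq_self, inner_sub_left,
      Complex.sub_re, re_inner_self]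
    linarith

theorem norm_apply_le (hA : IsPositiveContraction A) (x : E) : ‖A x‖ ≤ ‖x‖ :=
  by
  have := (hA.norm_sq_le x).trans (hA.le_one x)
  exact (sq_le_sq₀ (norm_nonneg _) (norm_nonneg _)).1 this

theorem norm_sub_apply_le (hA : IsPositiveContraction A) (x : E) : ‖x - A x‖ ≤ ‖x‖ :=
  hA.one_sub.norm_apply_le x

/-- This identifies the kernel with the null set of the quadratic form, which is how `V` is
described. -/
theorem apply_eq_zero_iff (hA : IsPositiveContraction A) (x : E) :
    A x = 0 ↔ (⟪A x, x⟫_ℂ).re = 0 := by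
  refine ⟨fun h => by simp [h], fun h => ?_⟩
  have h1 := hA.norm_sq_le x
  rw [h] at h1
  exact norm_eq_zero.1 (by nlinarith [norm_nonneg (A x)])

theorem apply_mem_orthogonal (hA : IsPositiveContraction A) (x : E) : A x ∈ A.kerᗮ := by
  intro v hv
  have hv' : A v = 0 := hv
  rw [← hA.symm, hv', inner_zero_left]

/-- `C` is a Poincaré constant for the semi-norm `⟪A ·, ·⟫` modulo the kernel of `A`. -/
def PoincareBound (A : E →L[ℂ] E) (C : ℝ) : Prop :=
  0 < C ∧ ∀ w ∈ A.kerᗮ, ‖w‖ ^ 2 ≤ C ^ 2 * (⟪A w, w⟫_ℂ).re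

theorem eq_of_apply_eq {w w' : E} (hw : w ∈ A.kerᗮ) (hw' : w' ∈ A.kerᗮ) (h : A w = A w') :
    w = w' := by
  have h1 : w - w' ∈ A.ker := by
    change A (w - w') = 0
    rw [map_sub, h, sub_self]
  have h2 : ⟪w - w', w - w'⟫_ℂ = 0 := (A.kerᗮ.sub_mem hw hw') _ h1
  exact sub_eq_zero.1 (inner_self_eq_zero.1 h2)

/-- Pairing the equation for `u (n + 1)` with itself and applying the Poincaré bound gains `C ^ 2`
at each step, because `1 - A` does not increase norms. -/
theorem norm_expansion_le (hA : IsPositiveContraction A) {C : ℝ} (hC : PoincareBound A C)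
    {F : E} {u : ℕ → E} (h0 : A (u 0) = 0)
    (hu : ∀ n, u (n + 1) ∈ A.kerᗮ ∧
      A (u (n + 1)) = (if n = 0 then F else 0) - (u n - A (u n))) (n : ℕ) :
    ‖u (n + 1)‖ ≤ C ^ (2 * (n + 1)) * ‖F‖ := by
  have hstep : ∀ (w G : E), w ∈ A.kerᗮ → (⟪A w, w⟫_ℂ).re ≤ ‖G‖ * ‖w‖ → ‖w‖ ≤ C ^ 2 * ‖G‖ := by
    intro w G hw h
    rcases eq_or_ne ‖w‖ 0 with hz | hz
    · rw [hz]; positivity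
    · have hpos : 0 < ‖w‖ := lt_of_le_of_ne (norm_nonneg _) (Ne.symm hz)
      have h1 := hC.2 w hw
      have h2 : C ^ 2 * (⟪A w, w⟫_ℂ).re ≤ C ^ 2 * (‖G‖ * ‖w‖) := by gcongr
      have h3 : ‖w‖ * ‖w‖ ≤ (C ^ 2 * ‖G‖) * ‖w‖ := by nlinarith
      exact le_of_mul_le_mul_right h3 hpos
  induction n with
  | zero =>
    have h1 := hu 0
    simp only [if_true, h0, sub_zero] at h1
    -- The right-hand side is `F - u 0`, but `u 0` is orthogonal to `u 1`, so only `F` contributes.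
    have h2 : ⟪u 0, u (0 + 1)⟫_ℂ = 0 := h1.1 _ h0
    have := hstep (u (0 + 1)) F h1.1 (by
      rw [h1.2, inner_sub_left, h2, sub_zero]
      exact re_inner_le_norm (𝕜 := ℂ) _ _)
    simpa using this
  | succ n ih =>
    have h1 := hu (n + 1)
    simp only [Nat.add_eq_zero_iff, one_ne_zero, and_false, if_false, zero_sub] at h1
    have := hstep (u (n + 1 + 1)) (u (n + 1)) h1.1 (by
      rw [h1.2]
      refine (re_inner_le_norm (𝕜 := ℂ) _ _).trans ?_
      rw [norm_neg]
      gcongr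
      exact hA.norm_sub_apply_le _)
    calc _ ≤ C ^ 2 * ‖u (n + 1)‖ := this
      _ ≤ C ^ 2 * (C ^ (2 * (n + 1)) * ‖F‖) := by gcongr
      _ = _ := by ring

/-! ### Solvability and the error estimate in a complete space. -/

variable [CompleteSpace E]

/-- Adding the projection onto the kernel makes `A` coercive on the whole space. In the solution of
the modified equation the kernel component also lies in `A.kerᗮ`, hence vanishes. -/
theorem exists_apply_eq (hA : IsPositiveContraction A) {C : ℝ} (hC : PoincareBound A C)
    {g : E} (hg : g ∈ A.kerᗮ) : ∃ w ∈ A.kerᗮ, A w = g := by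
  have hcl : IsClosed (A.ker : Set E) := A.isClosed_ker
  have : CompleteSpace A.ker := hcl.completeSpace_coe
  have hsurj : Function.Surjective (A + A.ker.starProjection) := by
    refine surjective_of_coercive (c := min 1 (C ^ 2)⁻¹) ?_ ?_
    · have := hC.1
      positivity
    · intro x
      obtain ⟨v, hv, w, hw, rfl⟩ := A.ker.exists_add_mem_mem_orthogonal x
      have hv' : A v = 0 := hv
      have hvw : ⟪v, w⟫_ℂ = 0 := hw v hv
      have hwv : ⟪w, v⟫_ℂ = 0 := inner_eq_zero_symm.1 hvw
      have hAwv : ⟪A w, v⟫_ℂ = 0 := by rw [hA.symm, hv', inner_zero_right]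
      have hp : A.ker.starProjection (v + w) = v := by
        rw [map_add, Submodule.starProjection_eq_self_iff.2 hv,
          (Submodule.starProjection_apply_eq_zero_iff _).2 hw, add_zero]
      have hn : ‖v + w‖ ^ 2 = ‖v‖ ^ 2 + ‖w‖ ^ 2 := by
        rw [← re_inner_self, ← re_inner_self, ← re_inner_self]
        simp only [inner_add_left, inner_add_right, hvw, hwv, add_zero, zero_add, Complex.add_re]
      rw [add_apply, hp, map_add, hv', zero_add, hn]
      simp only [inner_add_left, inner_add_right, hvw, hAwv, Complex.add_re, re_inner_self,
        Complex.zero_re]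
      have hw2 := hC.2 w hw
      have hCpos : 0 < C ^ 2 := by have := hC.1; positivity
      have h1 : (C ^ 2)⁻¹ * ‖w‖ ^ 2 ≤ (⟪A w, w⟫_ℂ).re := by
        rw [inv_mul_le_iff₀ hCpos]; exact hw2
      have h2 : min 1 (C ^ 2)⁻¹ * ‖v‖ ^ 2 ≤ 1 * ‖v‖ ^ 2 := by gcongr; exact min_le_left _ _
      have h3 : min 1 (C ^ 2)⁻¹ * ‖w‖ ^ 2 ≤ (C ^ 2)⁻¹ * ‖w‖ ^ 2 := by
        gcongr; exact min_le_right _ _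
      linarith
  obtain ⟨x, hx⟩ := hsurj g
  obtain ⟨v, hv, w, hw, rfl⟩ := A.ker.exists_add_mem_mem_orthogonal x
  have hv' : A v = 0 := hv
  refine ⟨w, hw, ?_⟩
  have hp : A.ker.starProjection (v + w) = v := by
    rw [map_add, Submodule.starProjection_eq_self_iff.2 hv,
      (Submodule.starProjection_apply_eq_zero_iff _).2 hw, add_zero]
  rw [add_apply, hp, map_add, hv', zero_add] at hx
  have h1 : v ∈ A.kerᗮ := by
    have : v = g - A w := by rw [← hx]; abel
    rw [this]
    exact A.kerᗮ.sub_mem hg (hA.apply_mem_orthogonal w)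
  have h2 : v = 0 := inner_self_eq_zero.1 (h1 v hv)
  rw [← hx, h2, add_zero]

/-- If `(ε² (1 - A) + A) r = A x` then `‖r‖ ≤ ‖x‖`. -/
theorem norm_le_of_resolvent (hA : IsPositiveContraction A) {ε : ℝ} (hε : ε ∈ Ioo (0 : ℝ) 1)
    {r x : E} (h : ((ε ^ 2 : ℝ) : ℂ) • (r - A r) + A r = A x) : ‖r‖ ≤ ‖x‖ := by
  obtain ⟨hε0, hε1⟩ := hε
  have hε2 : ε ^ 2 < 1 := by nlinarith
  have hε2' : 0 < ε ^ 2 := by positivity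
  let D : E →L[ℂ] E := ((ε ^ 2 : ℝ) : ℂ) • (1 - A) + A
  have hDa : ∀ x, D x = ((ε ^ 2 : ℝ) : ℂ) • (x - A x) + A x := fun x => by simp [D]
  have hDc : ∀ x, ε ^ 2 * ‖x‖ ^ 2 ≤ (⟪D x, x⟫_ℂ).re := by
    intro x
    have h1 := hA.nonneg x
    rw [hDa]
    simp only [inner_add_left, inner_smul_left, inner_sub_left, Complex.conj_ofReal,
      Complex.add_re, Complex.re_ofReal_mul, Complex.sub_re, re_inner_self]
    nlinarith
  have hDinj : ∀ x, D x = 0 → x = 0 := by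
    intro x hx
    have h1 := hDc x
    rw [hx, inner_zero_left, Complex.zero_re] at h1
    have h2 : ‖x‖ ^ 2 ≤ 0 := by
      by_contra hcon
      push Not at hcon
      have := mul_pos hε2' hcon
      linarith
    exact norm_eq_zero.1 (by nlinarith [norm_nonneg x])
  -- With `x = D z`, and `A` commuting with `D`, injectivity gives `r = A z`; what remains is `‖A z‖
  -- ≤ ‖D z‖`.
  obtain ⟨z, rfl⟩ := surjective_of_coercive hε2' hDc x
  have hr : r = A z := by
    rw [← sub_eq_zero]
    apply hDinj
    rw [map_sub, hDa r, h, hDa z, hDa (A z)]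
    simp
  have hz1 := hA.norm_sq_le z
  -- The cross term is nonnegative by `norm_sq_le`.
  have hexp : ‖D z‖ ^ 2 = ‖A z‖ ^ 2 + 2 * (ε ^ 2 * ((⟪A z, z⟫_ℂ).re - ‖A z‖ ^ 2))
      + ‖((ε ^ 2 : ℝ) : ℂ) • (z - A z)‖ ^ 2 := by
    have h1 := norm_add_sq (𝕜 := ℂ) (A z) (((ε ^ 2 : ℝ) : ℂ) • (z - A z))
    rw [hDa, add_comm, h1, inner_smul_right, inner_sub_right]
    congr 3
    change (((ε ^ 2 : ℝ) : ℂ) * (⟪A z, z⟫_ℂ - ⟪A z, A z⟫_ℂ)).re = _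
    rw [Complex.re_ofReal_mul, Complex.sub_re, re_inner_self]
  rw [hr]
  refine (sq_le_sq₀ (norm_nonneg _) (norm_nonneg _)).1 ?_
  rw [hexp]
  have : 0 ≤ ε ^ 2 * ((⟪A z, z⟫_ℂ).re - ‖A z‖ ^ 2) := mul_nonneg hε2'.le (by linarith)
  have : 0 ≤ ‖((ε ^ 2 : ℝ) : ℂ) • (z - A z)‖ ^ 2 := by positivity
  linarith

/-- The resolvent equation is solvable. -/
theorem exists_resolvent (hA : IsPositiveContraction A) {ε : ℝ} (hε : ε ∈ Ioo (0 : ℝ) 1) (F : E) :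
    ∃ u, u - A u + (((ε ^ 2)⁻¹ : ℝ) : ℂ) • A u = F := by
  obtain ⟨hε0, hε1⟩ := hε
  have hε2 : 1 ≤ (ε ^ 2)⁻¹ := by
    rw [one_le_inv₀ (by positivity)]; nlinarith
  let D : E →L[ℂ] E := (1 - A) + (((ε ^ 2)⁻¹ : ℝ) : ℂ) • A
  have hDa : ∀ x, D x = x - A x + (((ε ^ 2)⁻¹ : ℝ) : ℂ) • A x := fun x => by simp [D]
  obtain ⟨u, hu⟩ := surjective_of_coercive (L := D) (c := 1) one_pos (fun x => by
    have h1 := hA.nonneg x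
    rw [hDa]
    simp only [inner_add_left, inner_smul_left, inner_sub_left, Complex.conj_ofReal,
      Complex.add_re, Complex.re_ofReal_mul, Complex.sub_re, re_inner_self]
    nlinarith) F
  exact ⟨u, by rw [← hDa, hu]⟩

theorem eq_of_resolvent (hA : IsPositiveContraction A) {ε : ℝ} (hε : ε ∈ Ioo (0 : ℝ) 1) {u w : E}
    (h : u - A u + (((ε ^ 2)⁻¹ : ℝ) : ℂ) • A u = w - A w + (((ε ^ 2)⁻¹ : ℝ) : ℂ) • A w) :
    u = w := by
  have hne : ((ε ^ 2 : ℝ) : ℂ) ≠ 0 := by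
    have := hε.1
    exact_mod_cast (by positivity : ε ^ 2 ≠ 0)
  have h1 : ((ε ^ 2 : ℝ) : ℂ) • ((u - w) - A (u - w)) + A (u - w) = A 0 := by
    have h2 := congrArg (fun z => ((ε ^ 2 : ℝ) : ℂ) • z) h
    simp only [smul_add, smul_smul, Complex.ofReal_inv, mul_inv_cancel₀ hne, one_smul] at h2
    rw [map_zero, map_sub]
    have h3 : ((ε ^ 2 : ℝ) : ℂ) • (u - w - (A u - A w)) =
        ((ε ^ 2 : ℝ) : ℂ) • (u - A u) - ((ε ^ 2 : ℝ) : ℂ) • (w - A w) := by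
      rw [← smul_sub]; congr 1; abel
    rw [h3]
    rw [← sub_eq_zero] at h2
    rw [← h2]
    abel
  have h2 := hA.norm_le_of_resolvent hε h1
  rw [norm_zero] at h2
  exact sub_eq_zero.1 (norm_eq_zero.1 (le_antisymm h2 (norm_nonneg _)))

/-- The terms of the expansion of the solution of the resolvent equation. -/
theorem exists_expansion (hA : IsPositiveContraction A) {C₀ : ℝ} (hC₀ : PoincareBound A C₀)
    (F : E) : ∃ u : ℕ → E, A (u 0) = 0 ∧ F - u 0 ∈ A.kerᗮ ∧
      ∀ n, u (n + 1) ∈ A.kerᗮ ∧ A (u (n + 1)) = (if n = 0 then F else 0) - (u n - A (u n)) := by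
  have hcl : IsClosed (A.ker : Set E) := A.isClosed_ker
  have : CompleteSpace A.ker := hcl.completeSpace_coe
  obtain ⟨u₀, hu₀, w, hw, hF⟩ := A.ker.exists_add_mem_mem_orthogonal F
  have hu₀' : A u₀ = 0 := hu₀
  obtain ⟨u₁, hu₁, hAu₁⟩ := hA.exists_apply_eq hC₀ hw
  -- The range of `A` lies in `A.kerᗮ`, so from the first corrector on the right-hand side meets the
  -- solvability condition automatically, and the recursion stays inside `A.kerᗮ`.
  have hnext : ∀ x : A.kerᗮ, ∃ y : A.kerᗮ, A y = 0 - (x - A x) := by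
    intro x
    obtain ⟨y, hy, hxy⟩ := hA.exists_apply_eq hC₀ (g := 0 - (x - A x))
      (A.kerᗮ.sub_mem A.kerᗮ.zero_mem (A.kerᗮ.sub_mem x.2 (hA.apply_mem_orthogonal _)))
    exact ⟨⟨y, hy⟩, hxy⟩
  choose g hg using hnext
  let v : ℕ → A.kerᗮ := fun n => g^[n] ⟨u₁, hu₁⟩
  refine ⟨fun n => if n = 0 then u₀ else v (n - 1), by simpa using hu₀', ?_, ?_⟩
  · simpa [hF] using hw
  · intro n
    rcases n with _ | n
    · refine ⟨by simpa [v] using hu₁, ?_⟩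
      simp [v, hu₀', hAu₁, hF]
    · refine ⟨by simp, ?_⟩
      have : v (n + 1) = g (v n) := by simp only [v, Function.iterate_succ_apply']
      simp only [Nat.add_eq_zero_iff, one_ne_zero, and_false, if_false, Nat.add_sub_cancel, this]
      exact hg (v n)

theorem norm_resolvent_sub_expansion_le (hA : IsPositiveContraction A) {C : ℝ}
    (hC : PoincareBound A C)
    {F : E} {u : ℕ → E} (h0 : A (u 0) = 0)
    (hu : ∀ n, u (n + 1) ∈ A.kerᗮ ∧
      A (u (n + 1)) = (if n = 0 then F else 0) - (u n - A (u n)))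
    {ε : ℝ} (hε : ε ∈ Ioo (0 : ℝ) 1) {w : E}
    (hw : w - A w + (((ε ^ 2)⁻¹ : ℝ) : ℂ) • A w = F) (N : ℕ) :
    ‖w - ∑ n ∈ Finset.range (N + 1), ((ε : ℂ) ^ (2 * n)) • u n‖
      ≤ C ^ (2 * (N + 1)) * ε ^ (2 * (N + 1)) * ‖F‖ := by
  have hne : (ε : ℂ) ≠ 0 := by exact_mod_cast hε.1.ne'
  have hw' : ((ε ^ 2 : ℝ) : ℂ) • (w - A w) + A w = (ε : ℂ) ^ 2 • F := by
    rw [← hw, smul_add, smul_smul]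
    push_cast
    rw [mul_inv_cancel₀ (pow_ne_zero 2 hne), one_smul]
  -- Telescoping: subtracting the next term cancels the current right-hand side and leaves, by the
  -- recursion, the following one.
  have key : ∀ N : ℕ, ((ε ^ 2 : ℝ) : ℂ) • ((w - ∑ n ∈ Finset.range (N + 1),
      ((ε : ℂ) ^ (2 * n)) • u n) - A (w - ∑ n ∈ Finset.range (N + 1),
      ((ε : ℂ) ^ (2 * n)) • u n)) + A (w - ∑ n ∈ Finset.range (N + 1),
      ((ε : ℂ) ^ (2 * n)) • u n) = A ((ε : ℂ) ^ (2 * (N + 1)) • u (N + 1)) := by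
    intro N
    induction N with
    | zero =>
      have h1 := (hu 0).2
      simp only [if_true, h0, sub_zero] at h1
      simp only [zero_add, Finset.sum_range_one, mul_zero, pow_zero, one_smul, map_sub, h0,
        sub_zero, mul_one, map_smul] at h1 ⊢
      rw [h1, smul_sub _ F, ← hw']
      push_cast
      module
    | succ N ih =>
      have h1 := (hu (N + 1)).2
      simp only [Nat.add_eq_zero_iff, one_ne_zero, and_false, if_false, zero_sub] at h1
      rw [Finset.sum_range_succ]
      set s := w - ∑ n ∈ Finset.range (N + 1), ((ε : ℂ) ^ (2 * n)) • u n with hs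
      have h2 : w - (∑ n ∈ Finset.range (N + 1), ((ε : ℂ) ^ (2 * n)) • u n
        + (ε : ℂ) ^ (2 * (N + 1)) • u (N + 1)) = s - (ε : ℂ) ^ (2 * (N + 1)) • u (N + 1) := by
        rw [hs]; abel
      rw [h2, map_smul, h1, map_sub]
      have h3 : A s = A ((ε : ℂ) ^ (2 * (N + 1)) • u (N + 1))
        - ((ε ^ 2 : ℝ) : ℂ) • (s - A s) := by rw [← ih]; abel
      simp only [map_smul] at h3 ⊢
      have h4 : ((ε ^ 2 : ℝ) : ℂ) • (s - (ε : ℂ) ^ (2 * (N + 1)) • u (N + 1)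
          - (A s - (ε : ℂ) ^ (2 * (N + 1)) • A (u (N + 1))))
          = ((ε ^ 2 : ℝ) : ℂ) • (s - A s) - ((ε ^ 2 : ℝ) : ℂ) •
          ((ε : ℂ) ^ (2 * (N + 1)) • (u (N + 1) - A (u (N + 1)))) := by module
      rw [h4]
      nth_rewrite 2 [h3]
      push_cast
      rw [show 2 * (N + 1 + 1) = 2 * (N + 1) + 2 by ring, pow_add]
      module
  have h1 := hA.norm_le_of_resolvent hε (key N)
  have h2 := hA.norm_expansion_le hC h0 hu N
  refine h1.trans ?_
  rw [norm_smul, norm_pow, Complex.norm_real, Real.norm_of_nonneg hε.1.le]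
  calc ε ^ (2 * (N + 1)) * ‖u (N + 1)‖
      ≤ ε ^ (2 * (N + 1)) * (C ^ (2 * (N + 1)) * ‖F‖) := by
        have := hε.1
        gcongr
    _ = _ := by ring

end IsPositiveContraction

end Hilbert

end HighContrast

/-! ### Primitives and weak derivatives on the unit interval -/

namespace HighContrast

/-- Lebesgue measure on `Y = (0,1)`. -/
noncomputable abbrev μY : Measure ℝ := volume.restrict (Ioo (0 : ℝ) 1)

instance : IsProbabilityMeasure μY := ⟨by simp⟩

theorem integrable_L2Y (g : L2Y) : Integrable g μY := (Lp.memLp g).integrable (by norm_num)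

/-- The functional `g ↦ ∫_0^y g`. -/
noncomputable def primAt (y : ℝ) : L2Y →L[ℂ] ℂ :=
  innerSL ℂ (indicatorConstLp 2 (measurableSet_Iic (a := y)) (measure_ne_top μY _) (1 : ℂ))

theorem primAt_apply (y : ℝ) (g : L2Y) : primAt y g = ∫ t in Iic y, g t ∂μY :=
  L2.inner_indicatorConstLp_one _ _ g

theorem norm_primAt_le (y : ℝ) (g : L2Y) : ‖primAt y g‖ ≤ ‖g‖ := by
  have h1 : ‖indicatorConstLp 2 (measurableSet_Iic (a := y)) (measure_ne_top μY _) (1 : ℂ)‖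
      ≤ 1 := by
    refine norm_indicatorConstLp_le.trans ?_
    rw [norm_one, one_mul]
    exact Real.rpow_le_one measureReal_nonneg measureReal_le_one (by positivity)
  calc ‖primAt y g‖ ≤ _ * ‖g‖ := norm_inner_le_norm (𝕜 := ℂ) _ g
    _ ≤ 1 * ‖g‖ := by gcongr
    _ = ‖g‖ := one_mul _

theorem continuous_primAt (g : L2Y) : Continuous fun y => primAt y g := by
  have h : (fun y => primAt y g) = fun y => primAt 0 g + ∫ t in (0 : ℝ)..y, g t ∂μY := by
    ext y
    rw [primAt_apply, primAt_apply, ← intervalIntegral.integral_Iic_sub_Iic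
      (integrable_L2Y g).integrableOn (integrable_L2Y g).integrableOn]
    ring
  rw [h]
  exact continuous_const.add ((integrable_L2Y g).continuous_primitive 0)

theorem primAt_zero (g : L2Y) : primAt 0 g = 0 := by
  rw [primAt_apply, Measure.restrict_restrict measurableSet_Iic]
  have : Iic (0 : ℝ) ∩ Ioo 0 1 = ∅ := by
    ext x; simp only [mem_inter_iff, mem_Iic, mem_Ioo, mem_empty_iff_false]; grind
  simp [this]

theorem primAt_one (g : L2Y) : primAt 1 g = ∫ t, g t ∂μY := by
  rw [primAt_apply, Measure.restrict_restrict measurableSet_Iic]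
  have : Iic (1 : ℝ) ∩ Ioo 0 1 = Ioo 0 1 := by
    ext x; simp only [mem_inter_iff, mem_Iic, mem_Ioo]; grind
  rw [this]

theorem memLp_primAt (g : L2Y) : MemLp (fun y => primAt y g) 2 μY :=
  MemLp.of_bound (continuous_primAt g).aestronglyMeasurable ‖g‖
    (Filter.Eventually.of_forall fun y => norm_primAt_le y g)

/-- The primitive `y ↦ ∫_0^y g` as a bounded operator on `L²(Y)`. -/
noncomputable def prim : L2Y →L[ℂ] L2Y :=
  LinearMap.mkContinuous
    { toFun := fun g => (memLp_primAt g).toLp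
      map_add' := fun f g => by
        rw [← MemLp.toLp_add]
        congr 1
        ext y
        simp
      map_smul' := fun c g => by
        rw [RingHom.id_apply, ← MemLp.toLp_const_smul]
        congr 1
        ext y
        simp } 1 (fun g => by
      have h := Lp.norm_le_of_ae_bound (f := (memLp_primAt g).toLp) (norm_nonneg g) (by
        filter_upwards [(memLp_primAt g).coeFn_toLp] with y hy
        rw [hy]
        exact norm_primAt_le y g)
      simpa [measureUnivNNReal] using h)

theorem coeFn_prim (g : L2Y) : prim g =ᵐ[μY] fun y => primAt y g :=
  (memLp_primAt g).coeFn_toLp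

theorem norm_prim_le (g : L2Y) : ‖prim g‖ ≤ ‖g‖ :=
  prim.le_of_opNorm_le (LinearMap.mkContinuous_norm_le _ zero_le_one _) g |>.trans_eq (one_mul _)

/-- The constant functions. -/
noncomputable def constY : ℂ →L[ℂ] L2Y := Lp.constL 2 μY ℂ

theorem coeFn_constY (c : ℂ) : constY c =ᵐ[μY] fun _ => c := Lp.coeFn_const _ _ _

theorem primAt_one_constY (c : ℂ) : primAt 1 (constY c) = c := by
  rw [primAt_one, integral_congr_ae (coeFn_constY c)]
  simp

/-- The fundamental theorem of calculus with `φ 1 = 0`. The endpoint `t = 0` serves the constants,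
interior `t` the Fubini argument for `prim`. -/
theorem integral_Ioo_deriv {φ : ℝ → ℝ} (hφ : ContDiff ℝ ∞ φ) (hs : tsupport φ ⊆ Ioo 0 1) {t : ℝ}
    (ht : t ∈ Ico (0 : ℝ) 1) : ∫ y in Ici t, ((deriv φ y : ℝ) : ℂ) ∂μY = -(φ t : ℂ) := by
  have h1 : φ 1 = 0 := by
    by_contra hne
    exact (lt_irrefl (1 : ℝ)) (hs (subset_tsupport _ hne)).2
  have hset : (Ici t ∩ Ioo 0 1 : Set ℝ) =ᵐ[volume] Ioc t 1 := by
    have : (Ici t ∩ Ioo 0 1 : Set ℝ) =ᵐ[volume] (Ioo t 1 : Set ℝ) := by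
      rcases eq_or_lt_of_le ht.1 with h | h
      · have : (Ici t ∩ Ioo 0 1 : Set ℝ) = Ioo t 1 := by
          ext x; simp only [mem_inter_iff, mem_Ici, mem_Ioo]; grind
        exact Filter.Eventually.of_forall fun x => by rw [this]
      · have : (Ici t ∩ Ioo 0 1 : Set ℝ) = Ico t 1 := by
          ext x; simp only [mem_inter_iff, mem_Ici, mem_Ioo, mem_Ico]; grind
        rw [this]
        exact Ioo_ae_eq_Ico.symm
    exact this.trans Ioo_ae_eq_Ioc
  rw [Measure.restrict_restrict measurableSet_Ici, Measure.restrict_congr_set hset,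
    integral_complex_ofReal, ← intervalIntegral.integral_of_le ht.2.le,
    intervalIntegral.integral_deriv_eq_sub
      (fun x _ => (hφ.differentiable (by simp)).differentiableAt)
      ((hφ.continuous_deriv (by simp)).intervalIntegrable _ _), h1]
  simp

theorem hasWeakDeriv_constY (c : ℂ) : HasWeakDeriv (constY c) 0 := by
  intro φ hφ _ hs
  have h0 : φ 0 = 0 := by
    by_contra hne
    exact (lt_irrefl (0 : ℝ)) (hs (subset_tsupport _ hne)).1
  have h1 : ∫ y in Ioo (0 : ℝ) 1, (0 : L2Y) y * ((φ y : ℝ) : ℂ) = 0 := by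
    refine integral_eq_zero_of_ae ?_
    filter_upwards [Lp.coeFn_zero ℂ 2 μY] with y hy
    rw [hy]; simp
  rw [h1, neg_zero]
  have h2 : ∫ y in Ioo (0 : ℝ) 1, constY c y * ((deriv φ y : ℝ) : ℂ)
      = ∫ y in Ioo (0 : ℝ) 1, c * ((deriv φ y : ℝ) : ℂ) := by
    refine integral_congr_ae ?_
    filter_upwards [coeFn_constY c] with y hy
    rw [hy]
  have h3 := integral_Ioo_deriv hφ hs (t := 0) (by simp)
  rw [Measure.restrict_restrict measurableSet_Ici, h0] at h3
  have : Ici (0 : ℝ) ∩ Ioo 0 1 = Ioo 0 1 := by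
    ext x; simp only [mem_inter_iff, mem_Ici, mem_Ioo]; grind
  rw [this] at h3
  rw [h2, integral_const_mul, h3]
  simp

/-- Fubini on the triangle `t ≤ y`: the inner integral of `deriv φ` over `y ≥ t` is `-φ t`. -/
theorem hasWeakDeriv_prim (g : L2Y) : HasWeakDeriv (prim g) g := by
  intro φ hφ hc hs
  have hd : Continuous (deriv φ) := hφ.continuous_deriv (by simp)
  have hint : Integrable (fun y => ((deriv φ y : ℝ) : ℂ)) μY := by
    obtain ⟨C, hC⟩ := hc.deriv.exists_bound_of_continuous hd
    refine Integrable.of_bound (C := C)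
      (Complex.continuous_ofReal.comp hd).aestronglyMeasurable ?_
    exact Filter.Eventually.of_forall fun y => by simpa using hC y
  have hS : MeasurableSet {p : ℝ × ℝ | p.2 ≤ p.1} := measurableSet_le measurable_snd measurable_fst
  have hprod : Integrable (Function.uncurry fun y t : ℝ =>
      {p : ℝ × ℝ | p.2 ≤ p.1}.indicator (fun p => ((deriv φ p.1 : ℝ) : ℂ) * g p.2) (y, t))
      (μY.prod μY) := (hint.mul_prod (integrable_L2Y g)).indicator hS
  calc ∫ y in Ioo (0 : ℝ) 1, prim g y * ((deriv φ y : ℝ) : ℂ)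
      = ∫ y, ∫ t, {p : ℝ × ℝ | p.2 ≤ p.1}.indicator
          (fun p => ((deriv φ p.1 : ℝ) : ℂ) * g p.2) (y, t) ∂μY ∂μY := by
        refine integral_congr_ae ?_
        filter_upwards [coeFn_prim g] with y hy
        rw [hy, primAt_apply, ← integral_indicator measurableSet_Iic, ← integral_mul_const]
        refine integral_congr_ae (Filter.Eventually.of_forall fun t => ?_)
        by_cases h : t ≤ y
        · simp [indicator, h, mul_comm]
        · simp [indicator, h]
    _ = ∫ t, ∫ y, {p : ℝ × ℝ | p.2 ≤ p.1}.indicator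
          (fun p => ((deriv φ p.1 : ℝ) : ℂ) * g p.2) (y, t) ∂μY ∂μY :=
        integral_integral_swap hprod
    _ = ∫ t, -(g t * ((φ t : ℝ) : ℂ)) ∂μY := by
        refine integral_congr_ae ?_
        filter_upwards [ae_restrict_mem measurableSet_Ioo] with t ht
        have h1 : ∀ y, {p : ℝ × ℝ | p.2 ≤ p.1}.indicator
            (fun p => ((deriv φ p.1 : ℝ) : ℂ) * g p.2) (y, t)
            = (Ici t).indicator (fun y => ((deriv φ y : ℝ) : ℂ)) y * g t := by
          intro y
          by_cases h : t ≤ y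
          · simp [indicator, h]
          · simp [indicator, h]
        simp only [h1]
        rw [integral_mul_const, integral_indicator measurableSet_Ici,
          integral_Ioo_deriv hφ hs ⟨ht.1.le, ht.2⟩]
        ring
    _ = _ := integral_neg _

/-- A smooth function of zero mean with compact support in `(0,1)` is the derivative of such a
function. -/
theorem exists_deriv_eq_of_integral_eq_zero {χ : ℝ → ℝ} (hχ : ContDiff ℝ ∞ χ)
    (hc : HasCompactSupport χ) (hs : tsupport χ ⊆ Ioo 0 1) (h0 : ∫ y in (0 : ℝ)..1, χ y = 0) :
    ∃ φ : ℝ → ℝ, ContDiff ℝ ∞ φ ∧ HasCompactSupport φ ∧ tsupport φ ⊆ Ioo 0 1 ∧ deriv φ = χ := by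
  -- The extra point keeps the set nonempty when `χ = 0`, so that a least and a greatest element
  -- exist.
  have hK : IsCompact (insert (1 / 2) (tsupport χ)) := hc.isCompact.insert _
  have hKs : insert (1 / 2) (tsupport χ) ⊆ Ioo 0 1 :=
    insert_subset (by constructor <;> norm_num) hs
  obtain ⟨a, ha, ha'⟩ := hK.exists_isLeast (insert_nonempty _ _)
  obtain ⟨b, hb, hb'⟩ := hK.exists_isGreatest (insert_nonempty _ _)
  have ha0 : 0 < a := (hKs ha).1
  have hb1 : b < 1 := (hKs hb).2
  have hab : a ≤ b := ha' hb
  have hz : ∀ y, y ∉ Icc a b → χ y = 0 := by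
    intro y hy
    by_contra hne
    have : y ∈ insert (1 / 2) (tsupport χ) := mem_insert_of_mem _ (subset_tsupport _ hne)
    exact hy ⟨ha' this, hb' this⟩
  have hder : ∀ y, HasDerivAt (fun y => ∫ t in (0 : ℝ)..y, χ t) (χ y) y := fun y =>
    intervalIntegral.integral_hasDerivAt_right (hχ.continuous.intervalIntegrable _ _)
      hχ.continuous.aestronglyMeasurable.stronglyMeasurableAtFilter hχ.continuous.continuousAt
  have hderiv : deriv (fun y => ∫ t in (0 : ℝ)..y, χ t) = χ := funext fun y => (hder y).deriv
  have hsupp : Function.support (fun y => ∫ t in (0 : ℝ)..y, χ t) ⊆ Icc a b := by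
    intro y hy
    by_contra hyn
    apply hy
    rw [mem_Icc, not_and_or, not_le, not_le] at hyn
    rcases hyn with h | h
    · refine intervalIntegral.integral_zero_ae (Filter.Eventually.of_forall fun t ht => ?_)
      refine hz t fun ht' => ?_
      have : t ≤ max 0 y := ht.2
      rcases le_max_iff.1 this with h' | h' <;> linarith [ht'.1]
    · change ∫ t in (0 : ℝ)..y, χ t = 0
      rw [← intervalIntegral.integral_add_adjacent_intervals (b := 1)
        (hχ.continuous.intervalIntegrable _ _) (hχ.continuous.intervalIntegrable _ _), h0, zero_add]
      refine intervalIntegral.integral_zero_ae (Filter.Eventually.of_forall fun t ht => ?_)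
      refine hz t fun ht' => ?_
      have : min 1 y < t := ht.1
      rcases min_lt_iff.1 this with h' | h' <;> linarith [ht'.2]
  have htsupp : tsupport (fun y => ∫ t in (0 : ℝ)..y, χ t) ⊆ Icc a b :=
    closure_minimal hsupp isClosed_Icc
  refine ⟨fun y => ∫ t in (0 : ℝ)..y, χ t, ?_, ?_, ?_, hderiv⟩
  · rw [contDiff_infty_iff_deriv, hderiv]
    exact ⟨fun y => (hder y).differentiableAt, hχ⟩
  · exact HasCompactSupport.of_support_subset_isCompact isCompact_Icc hsupp
  · exact htsupp.trans fun y hy => ⟨ha0.trans_le hy.1, hy.2.trans_lt hb1⟩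

/-- Du Bois-Reymond's lemma. -/
theorem eq_constY_of_hasWeakDeriv_zero {u : L2Y} (hu : HasWeakDeriv u 0) :
    ∃ c, u = constY c := by
  let β : ContDiffBump (1 / 2 : ℝ) := ⟨1 / 8, 1 / 4, by norm_num, by norm_num⟩
  set η : ℝ → ℝ := β.normed volume with hη
  have hηd : ContDiff ℝ ∞ η := β.contDiff_normed
  have hηc : HasCompactSupport η := β.hasCompactSupport_normed
  have hηs : tsupport η ⊆ Ioo 0 1 := by
    rw [hη, β.tsupport_normed_eq, Real.closedBall_eq_Icc]
    intro y hy
    have h1 := hy.1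
    have h2 := hy.2
    change (1 / 2 : ℝ) - 1 / 4 ≤ y at h1
    change y ≤ (1 / 2 : ℝ) + 1 / 4 at h2
    constructor <;> linarith
  have hfull : ∀ ψ : ℝ → ℝ, tsupport ψ ⊆ Ioo 0 1 → ∫ y in (0 : ℝ)..1, ψ y = ∫ y, ψ y := by
    intro ψ hψ
    rw [intervalIntegral.integral_of_le zero_le_one, setIntegral_eq_integral_of_forall_compl_eq_zero]
    intro y hy
    by_contra hne
    exact hy (Ioo_subset_Ioc_self (hψ (subset_tsupport _ hne)))
  have hη1 : ∫ y in (0 : ℝ)..1, η y = 1 := by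
    rw [hfull η hηs]; exact β.integral_normed
  set c : ℂ := ∫ y in Ioo (0 : ℝ) 1, u y * ((η y : ℝ) : ℂ) with hcdef
  refine ⟨c, ?_⟩
  have hloc : LocallyIntegrableOn (fun y => u y - c) (Ioo 0 1) volume := by
    have : IntegrableOn (fun y => u y - c) (Ioo 0 1) volume :=
      (integrable_L2Y u).sub (integrable_const c)
    exact this.locallyIntegrableOn
  have hae := isOpen_Ioo.ae_eq_zero_of_integral_contDiff_smul_eq_zero hloc (by
    intro ψ hψ hψc hψs
    -- Subtracting `m` times the unit-mass bump gives zero mean, so the difference is an admissible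
    -- derivative; testing with it yields `∫ u ψ = m c`.
    set m : ℝ := ∫ y in (0 : ℝ)..1, ψ y with hm
    have hχd : ContDiff ℝ ∞ (fun y => ψ y - m * η y) := hψ.sub (contDiff_const.mul hηd)
    have hχs' : tsupport (fun y => ψ y - m * η y) ⊆ tsupport ψ ∪ tsupport η := by
      refine closure_minimal ?_ ((isClosed_tsupport _).union (isClosed_tsupport _))
      intro y hy
      by_contra hn
      rw [mem_union, not_or] at hn
      apply hy
      simp [image_eq_zero_of_notMem_tsupport hn.1, image_eq_zero_of_notMem_tsupport hn.2]
    have hχs : tsupport (fun y => ψ y - m * η y) ⊆ Ioo 0 1 :=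
      hχs'.trans (union_subset hψs hηs)
    have hχc : HasCompactSupport (fun y => ψ y - m * η y) :=
      (hψc.isCompact.union hηc.isCompact).of_isClosed_subset (isClosed_tsupport _) hχs'
    have hχ0 : ∫ y in (0 : ℝ)..1, (ψ y - m * η y) = 0 := by
      rw [intervalIntegral.integral_sub (hψ.continuous.intervalIntegrable _ _)
        ((hηd.continuous.intervalIntegrable _ _).const_mul m),
        intervalIntegral.integral_const_mul, hη1, mul_one, sub_self]
    obtain ⟨φ, hφ, hφc, hφs, hφd⟩ := exists_deriv_eq_of_integral_eq_zero hχd hχc hχs hχ0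
    have h1 := hu φ hφ hφc hφs
    have h2 : ∫ y in Ioo (0 : ℝ) 1, (0 : L2Y) y * ((φ y : ℝ) : ℂ) = 0 := by
      refine integral_eq_zero_of_ae ?_
      filter_upwards [Lp.coeFn_zero ℂ 2 μY] with y hy
      rw [hy]; simp
    rw [h2, neg_zero, hφd] at h1
    have h3 : ∫ y in Ioo (0 : ℝ) 1, u y * ((ψ y : ℝ) : ℂ) = m * c := by
      have e1 := integrable_mul_of_continuous u hψ.continuous hψc
      have e2 := integrable_mul_of_continuous u hηd.continuous hηc
      have e3 : (fun y => u y * (((ψ y - m * η y : ℝ)) : ℂ))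
          = fun y => u y * ((ψ y : ℝ) : ℂ) - (m : ℂ) * (u y * ((η y : ℝ) : ℂ)) := by
        ext y; push_cast; ring
      rw [e3, integral_sub e1 (e2.const_mul _), integral_const_mul, ← hcdef, sub_eq_zero] at h1
      exact h1
    have h4 : ∫ y in Ioo (0 : ℝ) 1, ((ψ y : ℝ) : ℂ) = m := by
      rw [integral_complex_ofReal, hm, intervalIntegral.integral_of_le zero_le_one,
        integral_Ioc_eq_integral_Ioo]
    have hψi : Integrable (fun y => ((ψ y : ℝ) : ℂ)) μY :=
      ((hψ.continuous.integrable_of_hasCompactSupport hψc).ofReal).restrict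
    rw [← setIntegral_eq_integral_of_forall_compl_eq_zero (s := Ioo (0 : ℝ) 1)]
    · have e4 : (fun y => ψ y • (u y - c))
          = fun y => u y * ((ψ y : ℝ) : ℂ) - c * ((ψ y : ℝ) : ℂ) := by
        ext y; rw [Complex.real_smul]; ring
      rw [e4, integral_sub (integrable_mul_of_continuous u hψ.continuous hψc) (hψi.const_mul c),
        h3, integral_const_mul, h4]
      ring
    · intro y hy
      have : ψ y = 0 := by
        by_contra hne
        exact hy (hψs (subset_tsupport _ hne))
      rw [this, zero_smul])
  apply Lp.ext
  filter_upwards [coeFn_constY c, (ae_restrict_iff' measurableSet_Ioo).2 hae] with y h1 h2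
  rw [h1]
  exact sub_eq_zero.1 h2

/-! ### Description of `H1 θ` by a constant and a derivative. -/

theorem hasWeakDeriv_iff {u g : L2Y} : HasWeakDeriv u g ↔ ∃ c, u = constY c + prim g := by
  constructor
  · intro h
    have h1 : HasWeakDeriv (u + (-1 : ℂ) • prim g) (g + (-1 : ℂ) • g) :=
      h.add ((hasWeakDeriv_prim g).smul _)
    rw [neg_smul, one_smul, neg_smul, one_smul, add_neg_cancel] at h1
    obtain ⟨c, hc⟩ := eq_constY_of_hasWeakDeriv_zero h1
    exact ⟨c, by rw [← hc]; abel⟩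
  · rintro ⟨c, rfl⟩
    have := (hasWeakDeriv_constY c).add (hasWeakDeriv_prim g)
    rwa [zero_add] at this

/-- The continuous representative `c + primAt y g` has end values `c` and `c + primAt 1 g`, so
quasiperiodicity is a single scalar condition. Conversely, under it the product with `exp (-iθy)`
has equal end values and extends periodically through `AddCircle`. -/
theorem isQuasiperiodic_iff (θ : ℝ) (c : ℂ) (g : L2Y) :
    IsQuasiperiodic θ (constY c + prim g) ↔
      c + primAt 1 g = Complex.exp (Complex.I * θ) * c := by
  have hU : (constY c + prim g : L2Y) =ᵐ[μY] fun y => c + primAt y g := by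
    filter_upwards [Lp.coeFn_add (constY c) (prim g), coeFn_constY c, coeFn_prim g] with y h1 h2 h3
    rw [h1, Pi.add_apply, h2, h3]
  have hUc : Continuous fun y => c + primAt y g := continuous_const.add (continuous_primAt g)
  constructor
  · rintro ⟨v, hv, hvp, hev⟩
    have hVc : Continuous fun y : ℝ => Complex.exp (Complex.I * θ * y) * v y := by fun_prop
    have hae : (fun y => c + primAt y g) =ᵐ[volume.restrict (Icc (0 : ℝ) 1)]
        fun y : ℝ => Complex.exp (Complex.I * θ * y) * v y := by
      rw [Measure.restrict_congr_set Ioo_ae_eq_Icc.symm]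
      exact hU.symm.trans hev
    have heq := Measure.eqOn_Icc_of_ae_eq volume zero_ne_one hae hUc.continuousOn hVc.continuousOn
    have h0 := heq (left_mem_Icc.2 zero_le_one)
    have h1 := heq (right_mem_Icc.2 zero_le_one)
    have hp : v 1 = v 0 := by simpa using hvp 0
    simp only [primAt_zero, add_zero, Complex.ofReal_zero, mul_zero, Complex.exp_zero, one_mul]
      at h0
    simp only [Complex.ofReal_one, mul_one, hp, ← h0] at h1
    exact h1
  · intro h
    let w : ℝ → ℂ := fun y => Complex.exp (-(Complex.I * θ * y)) * (c + primAt y g)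
    have hw : Continuous w := by
      have : Continuous fun y : ℝ => Complex.exp (-(Complex.I * θ * y)) := by fun_prop
      exact this.mul hUc
    have hw01 : w 0 = w 1 := by
      simp only [w, primAt_zero, h]
      rw [← mul_assoc, ← Complex.exp_add]
      simp
    refine ⟨fun y => AddCircle.liftIco 1 0 w (y : AddCircle (1 : ℝ)), ?_, ?_, ?_⟩
    · exact (AddCircle.liftIco_zero_continuous hw01 hw.continuousOn).comp
        (AddCircle.continuous_mk' 1)
    · intro y
      simp
    · filter_upwards [hU, ae_restrict_mem measurableSet_Ioo] with y h1 h2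
      rw [h1, AddCircle.liftIco_zero_coe_apply ⟨h2.1.le, h2.2⟩, ← mul_assoc, ← Complex.exp_add]
      simp

theorem mem_H1_iff {θ : ℝ} {p : L2Y × L2Y} : p ∈ H1 θ ↔ ∃ c, p.1 = constY c + prim p.2 ∧
    c + primAt 1 p.2 = Complex.exp (Complex.I * θ) * c := by
  constructor
  · rintro ⟨h1, h2⟩
    obtain ⟨c, hc⟩ := hasWeakDeriv_iff.1 h1
    rw [hc] at h2
    exact ⟨c, hc, (isQuasiperiodic_iff θ c p.2).1 h2⟩
  · rintro ⟨c, hc, h⟩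
    refine ⟨hasWeakDeriv_iff.2 ⟨c, hc⟩, ?_⟩
    rw [hc]
    exact (isQuasiperiodic_iff θ c p.2).2 h

/-- The constant is recovered continuously as `primAt 1 (u - prim g)`, so membership amounts to two
equations between continuous maps. -/
theorem isClosed_H1 (θ : ℝ) : IsClosed (H1 θ : Set (L2Y × L2Y)) := by
  have hset : (H1 θ : Set (L2Y × L2Y)) =
      {p | p.1 - prim p.2 = constY (primAt 1 (p.1 - prim p.2))} ∩
      {p | primAt 1 (p.1 - prim p.2) + primAt 1 p.2
        = Complex.exp (Complex.I * θ) * primAt 1 (p.1 - prim p.2)} := by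
    ext p
    rw [SetLike.mem_coe, mem_H1_iff]
    constructor
    · rintro ⟨c, hc, h⟩
      have h1 : p.1 - prim p.2 = constY c := by rw [hc]; abel
      have h2 : primAt 1 (p.1 - prim p.2) = c := by rw [h1, primAt_one_constY]
      exact ⟨by rw [mem_ofPred_eq, h2, h1], by rw [mem_ofPred_eq, h2, h]⟩
    · rintro ⟨h1, h2⟩
      refine ⟨_, ?_, h2⟩
      rw [mem_ofPred_eq] at h1
      rw [← h1]; abel
  rw [hset]
  refine (isClosed_eq ?_ ?_).inter (isClosed_eq ?_ ?_) <;> fun_prop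

instance (θ : ℝ) : CompleteSpace (H1 θ) := (isClosed_H1 θ).completeSpace_coe

end HighContrast

/-! ### Weighted `L²` forms and the graph norm -/

namespace HighContrast

theorem AdmissibleOn.exists_bounds {w : ℝ → ℝ} {S : Set ℝ} (hw : AdmissibleOn w S) :
    ∃ m M : ℝ, 0 < m ∧ 0 < M ∧ ∀ᵐ y ∂(volume.restrict S), m ≤ w y ∧ w y ≤ M := by
  have key : ∀ f : ℝ → ℝ, MemLp f ⊤ (volume.restrict S) →
      ∃ M : ℝ, 0 < M ∧ ∀ᵐ y ∂(volume.restrict S), f y ≤ M := by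
    intro f hf
    refine ⟨(eLpNormEssSup f (volume.restrict S)).toReal + 1, by positivity, ?_⟩
    have hfin : eLpNormEssSup f (volume.restrict S) ≠ ⊤ := by
      have := hf.eLpNorm_lt_top
      rw [eLpNorm_exponent_top] at this
      exact this.ne
    filter_upwards [enorm_ae_le_eLpNormEssSup f (volume.restrict S)] with y hy
    have h1 : ‖f y‖ ≤ (eLpNormEssSup f (volume.restrict S)).toReal := by
      rw [← toReal_enorm]
      exact ENNReal.toReal_mono hfin hy
    have h2 := le_abs_self (f y)
    rw [← Real.norm_eq_abs] at h2
    linarith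
  obtain ⟨M, hM, hM'⟩ := key w hw.memLp
  obtain ⟨m, hm, hm'⟩ := key _ hw.inv_memLp
  refine ⟨m⁻¹, M, by positivity, hM, ?_⟩
  filter_upwards [hM', hm', hw.pos] with y h1 h2 h3
  exact ⟨inv_le_of_inv_le₀ h3 h2, h1⟩

/-- The form `(f, g) ↦ ∫_S w f ḡ`. -/
noncomputable def wform (w : ℝ → ℝ) (S : Set ℝ) (f g : L2Y) : ℂ :=
  ∫ y in S, (w y : ℂ) * f y * (starRingEnd ℂ) (g y)

/-- The quadratic form `f ↦ ∫_S w |f|²`. -/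
noncomputable def wsq (w : ℝ → ℝ) (S : Set ℝ) (f : L2Y) : ℝ :=
  ∫ y in S, w y * ‖f y‖ ^ 2

section Weighted

variable {w : ℝ → ℝ} {S : Set ℝ}

theorem ae_restrict_of_L2Y (hS : S ⊆ Ioo 0 1) {p : ℝ → Prop} (h : ∀ᵐ y ∂μY, p y) :
    ∀ᵐ y ∂(volume.restrict S), p y :=
  ae_restrict_of_ae_restrict_of_subset hS h

theorem memLp_restrict (hS : S ⊆ Ioo 0 1) (f : L2Y) : MemLp f 2 (volume.restrict S) :=
  (Lp.memLp f).mono_measure (Measure.restrict_mono hS le_rfl)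

theorem integrable_norm_sq (hS : S ⊆ Ioo 0 1) (f : L2Y) :
    Integrable (fun y => ‖f y‖ ^ 2) (volume.restrict S) := (memLp_restrict hS f).norm.integrable_sq

theorem AdmissibleOn.integrable_form (hw : AdmissibleOn w S) (hS : S ⊆ Ioo 0 1) (f g : L2Y) :
    Integrable (fun y => (w y : ℂ) * f y * (starRingEnd ℂ) (g y)) (volume.restrict S) := by
  have h1 : Integrable (fun y => f y * (starRingEnd ℂ) (g y)) (volume.restrict S) :=
    (memLp_restrict hS f).integrable_mul (memLp_restrict hS g).star
  obtain ⟨m, M, hm, hM, hb⟩ := hw.exists_bounds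
  have h2 := h1.bdd_mul (f := fun y => (w y : ℂ)) (c := M)
    (Complex.continuous_ofReal.comp_aestronglyMeasurable hw.memLp.aestronglyMeasurable) (by
      filter_upwards [hb] with y hy
      rw [Complex.norm_real, Real.norm_of_nonneg (hm.le.trans hy.1)]
      exact hy.2)
  simpa only [mul_assoc] using h2

theorem AdmissibleOn.integrable_sq (hw : AdmissibleOn w S) (hS : S ⊆ Ioo 0 1) (f : L2Y) :
    Integrable (fun y => w y * ‖f y‖ ^ 2) (volume.restrict S) := by
  obtain ⟨m, M, hm, hM, hb⟩ := hw.exists_bounds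
  refine (integrable_norm_sq hS f).bdd_mul (c := M) hw.memLp.aestronglyMeasurable ?_
  filter_upwards [hb] with y hy
  rw [Real.norm_of_nonneg (hm.le.trans hy.1)]
  exact hy.2

theorem wform_conj_symm (w : ℝ → ℝ) (S : Set ℝ) (f g : L2Y) :
    (starRingEnd ℂ) (wform w S g f) = wform w S f g := by
  rw [wform, wform, ← integral_conj]
  congr 1
  ext y
  simp only [map_mul, Complex.conj_ofReal, Complex.conj_conj]
  ring

theorem AdmissibleOn.wform_add_left (hw : AdmissibleOn w S) (hS : S ⊆ Ioo 0 1) (f g k : L2Y) :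
    wform w S (f + g) k = wform w S f k + wform w S g k := by
  rw [wform, wform, wform, ← integral_add (hw.integrable_form hS f k) (hw.integrable_form hS g k)]
  refine integral_congr_ae ?_
  filter_upwards [ae_restrict_of_L2Y hS (Lp.coeFn_add f g)] with y hy
  rw [hy, Pi.add_apply]
  ring

theorem wform_smul_left (hS : S ⊆ Ioo 0 1) (c : ℂ) (f k : L2Y) :
    wform w S (c • f) k = c * wform w S f k := by
  rw [wform, wform, ← integral_const_mul]
  refine integral_congr_ae ?_
  filter_upwards [ae_restrict_of_L2Y hS (Lp.coeFn_smul c f)] with y hy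
  rw [hy, Pi.smul_apply, smul_eq_mul]
  ring

theorem wform_self (w : ℝ → ℝ) (S : Set ℝ) (f : L2Y) : wform w S f f = (wsq w S f : ℂ) := by
  rw [wform, wsq, ← integral_complex_ofReal]
  congr 1
  ext y
  rw [mul_assoc, Complex.mul_conj, Complex.normSq_eq_norm_sq]
  push_cast
  ring

theorem AdmissibleOn.wsq_nonneg (hw : AdmissibleOn w S) (f : L2Y) : 0 ≤ wsq w S f := by
  refine integral_nonneg_of_ae ?_
  filter_upwards [hw.pos] with y hy
  exact mul_nonneg hy.le (by positivity)

/-- The semi-inner product `(f, g) ↦ ∫_S w f̄ g`. -/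
noncomputable abbrev AdmissibleOn.core (hw : AdmissibleOn w S) (hS : S ⊆ Ioo 0 1) :
    PreInnerProductSpace.Core ℂ L2Y where
  inner f g := wform w S g f
  conj_inner_symm f g := wform_conj_symm w S g f
  re_inner_nonneg f := by
    rw [wform_self]
    exact hw.wsq_nonneg f
  add_left f g k := by
    rw [← wform_conj_symm, hw.wform_add_left hS, map_add, wform_conj_symm, wform_conj_symm]
  smul_left f g c := by
    rw [← wform_conj_symm, wform_smul_left hS, map_mul, wform_conj_symm]

/-- Cauchy–Schwarz for a form that degenerates when `S` misses part of `Y`, hence a pre-inner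
product core. -/
theorem AdmissibleOn.norm_wform_le (hw : AdmissibleOn w S) (hS : S ⊆ Ioo 0 1) (f g : L2Y) :
    ‖wform w S f g‖ ≤ √(wsq w S f) * √(wsq w S g) := by
  have h := @InnerProductSpace.Core.norm_inner_le_norm ℂ L2Y _ _ _ (hw.core hS) g f
  have hn : ∀ f, @norm L2Y (@InnerProductSpace.Core.toNorm ℂ L2Y _ _ _ (hw.core hS)) f
      = √(wsq w S f) := by
    intro f
    rw [@InnerProductSpace.Core.norm_eq_sqrt_re_inner ℂ L2Y _ _ _ (hw.core hS)]
    change √(RCLike.re (wform w S f f)) = _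
    rw [wform_self]
    rfl
  rw [hn, hn, mul_comm] at h
  exact h

theorem AdmissibleOn.exists_wsq_bounds (hw : AdmissibleOn w S) (hS : S ⊆ Ioo 0 1) :
    ∃ m M : ℝ, 0 < m ∧ 0 < M ∧ ∀ f : L2Y, m * ∫ y in S, ‖f y‖ ^ 2 ≤ wsq w S f ∧
      wsq w S f ≤ M * ∫ y in S, ‖f y‖ ^ 2 := by
  obtain ⟨m, M, hm, hM, hb⟩ := hw.exists_bounds
  refine ⟨m, M, hm, hM, fun f => ⟨?_, ?_⟩⟩
  · rw [← integral_const_mul]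
    refine integral_mono_ae ((integrable_norm_sq hS f).const_mul m) (hw.integrable_sq hS f) ?_
    filter_upwards [hb] with y hy
    exact mul_le_mul_of_nonneg_right hy.1 (by positivity)
  · rw [← integral_const_mul]
    refine integral_mono_ae (hw.integrable_sq hS f) ((integrable_norm_sq hS f).const_mul M) ?_
    filter_upwards [hb] with y hy
    exact mul_le_mul_of_nonneg_right hy.2 (by positivity)

theorem AdmissibleOn.wsq_eq_zero_iff (hw : AdmissibleOn w S) (hS : S ⊆ Ioo 0 1) (f : L2Y) :
    wsq w S f = 0 ↔ ∀ᵐ y ∂(volume.restrict S), f y = 0 := by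
  rw [wsq, integral_eq_zero_iff_of_nonneg_ae _ (hw.integrable_sq hS f)]
  · constructor
    · intro h
      filter_upwards [h, hw.pos] with y h1 h2
      simpa [h2.ne'] using h1
    · intro h
      filter_upwards [h] with y h1
      simp [h1]
  · filter_upwards [hw.pos] with y hy
    exact mul_nonneg hy.le (by positivity)

end Weighted

theorem integral_norm_sq_L2Y (f : L2Y) : ∫ y in Ioo (0 : ℝ) 1, ‖f y‖ ^ 2 = ‖f‖ ^ 2 := by
  have h := L2.inner_def (𝕜 := ℂ) f f
  rw [inner_self_eq_norm_sq_to_K] at h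
  have h2 : ∀ y, inner ℂ (f y) (f y) = ((‖f y‖ ^ 2 : ℝ) : ℂ) := fun y => by
    rw [inner_self_eq_norm_sq_to_K]; simp
  simp only [h2] at h
  rw [integral_complex_ofReal] at h
  refine (Complex.ofReal_injective ?_).symm
  rw [← h]
  simp

/-! ### The graph norm and the Hilbert space it defines. -/

namespace Cell

variable (K : Cell) {θ : ℝ}

theorem soft_subset : Ioo 0 K.h ⊆ Ioo (0 : ℝ) 1 := Ioo_subset_Ioo_right K.h_lt_one.le

theorem stiff_subset : Ioo K.h 1 ⊆ Ioo (0 : ℝ) 1 := Ioo_subset_Ioo_left K.h_pos.le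

theorem soft_eq (u v : H1 θ) : K.soft u v = wform K.a₀ (Ioo 0 K.h) (der u) (der v) := rfl

theorem stiff_eq (u v : H1 θ) : K.stiff u v = wform K.a₁ (Ioo K.h 1) (der u) (der v) := rfl

theorem innerρ_eq (f g : L2Y) : K.innerρ f g = wform K.ρ (Ioo 0 1) f g := rfl

theorem stiffNorm_eq (u : H1 θ) : K.stiffNorm u = √(wsq K.a₁ (Ioo K.h 1) (der u)) := rfl

theorem normρ_eq (f : L2Y) : K.normρ f = √(wsq K.ρ (Ioo 0 1) f) := rfl

/-- The square of the graph norm. -/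
noncomputable def graphSq (u : H1 θ) : ℝ :=
  wsq K.a₀ (Ioo 0 K.h) (der u) + wsq K.a₁ (Ioo K.h 1) (der u) + wsq K.ρ (Ioo 0 1) (fn u)

theorem graphNorm_eq (u : H1 θ) : K.graphNorm u = √(K.graphSq u) := rfl

theorem graphInner_self (u : H1 θ) : K.graphInner u u = (K.graphSq u : ℂ) := by
  rw [graphInner, soft_eq, stiff_eq, innerρ_eq, wform_self, wform_self, wform_self, graphSq]
  push_cast
  ring

theorem graphSq_nonneg (u : H1 θ) : 0 ≤ K.graphSq u :=
  add_nonneg (add_nonneg (K.adm_a₀.wsq_nonneg _) (K.adm_a₁.wsq_nonneg _)) (K.adm_ρ.wsq_nonneg _)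

theorem integral_phases (f : L2Y) :
    (∫ y in Ioo 0 K.h, ‖f y‖ ^ 2) + ∫ y in Ioo K.h 1, ‖f y‖ ^ 2 = ‖f‖ ^ 2 := by
  have hd : Disjoint (Ioo 0 K.h) (Ioo K.h 1) :=
    disjoint_left.2 fun x h1 h2 => lt_asymm h1.2 h2.1
  rw [← setIntegral_union hd measurableSet_Ioo (integrable_norm_sq K.soft_subset f)
    (integrable_norm_sq K.stiff_subset f), ← integral_norm_sq_L2Y]
  have h1 : (Ioo 0 K.h ∪ Ioo K.h 1 : Set ℝ) =ᵐ[volume] (Ioo 0 K.h ∪ Ico K.h 1 : Set ℝ) :=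
    (ae_eq_refl _).union Ioo_ae_eq_Ico
  rw [setIntegral_congr_set h1, Ioo_union_Ico_eq_Ioo K.h_pos K.h_lt_one.le]

/-- The graph norm is equivalent to the norm of `H¹(Y)`. -/
theorem exists_graphSq_bounds : ∃ m M : ℝ, 0 < m ∧ 0 < M ∧ ∀ (θ : ℝ) (u : H1 θ),
    m * (‖fn u‖ ^ 2 + ‖der u‖ ^ 2) ≤ K.graphSq u ∧
      K.graphSq u ≤ M * (‖fn u‖ ^ 2 + ‖der u‖ ^ 2) := by
  obtain ⟨m₀, M₀, hm₀, hM₀, h₀⟩ := K.adm_a₀.exists_wsq_bounds K.soft_subset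
  obtain ⟨m₁, M₁, hm₁, hM₁, h₁⟩ := K.adm_a₁.exists_wsq_bounds K.stiff_subset
  obtain ⟨m₂, M₂, hm₂, hM₂, h₂⟩ := K.adm_ρ.exists_wsq_bounds subset_rfl
  refine ⟨min m₀ (min m₁ m₂), M₀ + M₁ + M₂, by positivity, by positivity, fun θ u => ?_⟩
  have e₀ := h₀ (der u)
  have e₁ := h₁ (der u)
  have e₂ := h₂ (fn u)
  rw [integral_norm_sq_L2Y] at e₂
  have hI := K.integral_phases (der u)
  have p₀ : 0 ≤ ∫ y in Ioo 0 K.h, ‖der u y‖ ^ 2 := integral_nonneg fun y => by positivity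
  have p₁ : 0 ≤ ∫ y in Ioo K.h 1, ‖der u y‖ ^ 2 := integral_nonneg fun y => by positivity
  have p₂ : 0 ≤ ‖fn u‖ ^ 2 := by positivity
  rw [← hI, graphSq]
  constructor
  · have l₀ : min m₀ (min m₁ m₂) ≤ m₀ := min_le_left _ _
    have l₁ : min m₀ (min m₁ m₂) ≤ m₁ := (min_le_right _ _).trans (min_le_left _ _)
    have l₂ : min m₀ (min m₁ m₂) ≤ m₂ := (min_le_right _ _).trans (min_le_right _ _)
    have q₀ := mul_le_mul_of_nonneg_right l₀ p₀
    have q₁ := mul_le_mul_of_nonneg_right l₁ p₁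
    have q₂ := mul_le_mul_of_nonneg_right l₂ p₂
    rw [mul_add, mul_add]
    linarith [e₀.1, e₁.1, e₂.1]
  · have q₀ : M₀ * (∫ y in Ioo 0 K.h, ‖der u y‖ ^ 2) ≤
        (M₀ + M₁ + M₂) * ∫ y in Ioo 0 K.h, ‖der u y‖ ^ 2 := by gcongr; linarith
    have q₁ : M₁ * (∫ y in Ioo K.h 1, ‖der u y‖ ^ 2) ≤
        (M₀ + M₁ + M₂) * ∫ y in Ioo K.h 1, ‖der u y‖ ^ 2 := by gcongr; linarith
    have q₂ : M₂ * ‖fn u‖ ^ 2 ≤ (M₀ + M₁ + M₂) * ‖fn u‖ ^ 2 := by gcongr; linarith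
    rw [mul_add, mul_add]
    linarith [e₀.2, e₁.2, e₂.2]

/-- `H¹_θ(Y)` as a Hilbert space for the graph inner product. -/
def Hilb (_ : Cell) (θ : ℝ) : Type := H1 θ

/-- Only the algebraic structure is inherited; the norm comes from the graph inner product and must
not clash with the maximum norm of `L2Y × L2Y`. -/
noncomputable instance : AddCommGroup (K.Hilb θ) := inferInstanceAs (AddCommGroup (H1 θ))

noncomputable instance : Module ℂ (K.Hilb θ) := inferInstanceAs (Module ℂ (H1 θ))

/-- The identification of `H¹_θ(Y)` with the Hilbert space. -/
noncomputable def toHilb : H1 θ ≃ₗ[ℂ] K.Hilb θ := LinearEquiv.refl ℂ (H1 θ)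

theorem graphInner_conj_symm (u v : H1 θ) :
    (starRingEnd ℂ) (K.graphInner v u) = K.graphInner u v := by
  simp only [graphInner, soft_eq, stiff_eq, innerρ_eq, map_add, wform_conj_symm]

theorem graphInner_add_left (u v z : H1 θ) :
    K.graphInner (u + v) z = K.graphInner u z + K.graphInner v z := by
  have h1 : der (u + v) = der u + der v := rfl
  have h2 : fn (u + v) = fn u + fn v := rfl
  simp only [graphInner, soft_eq, stiff_eq, innerρ_eq, h1, h2,
    K.adm_a₀.wform_add_left K.soft_subset, K.adm_a₁.wform_add_left K.stiff_subset,
    K.adm_ρ.wform_add_left subset_rfl]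
  ring

theorem graphInner_smul_left (c : ℂ) (u z : H1 θ) :
    K.graphInner (c • u) z = c * K.graphInner u z := by
  have h1 : der (c • u) = c • der u := rfl
  have h2 : fn (c • u) = c • fn u := rfl
  simp only [graphInner, soft_eq, stiff_eq, innerρ_eq, h1, h2, wform_smul_left K.soft_subset,
    wform_smul_left K.stiff_subset, wform_smul_left (subset_refl (Ioo (0 : ℝ) 1))]
  ring

/-- The graph inner product, conjugate-linear in its first argument. -/
noncomputable abbrev graphCore (θ : ℝ) : InnerProductSpace.Core ℂ (K.Hilb θ) where
  inner u v := K.graphInner (K.toHilb.symm v) (K.toHilb.symm u)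
  conj_inner_symm u v := K.graphInner_conj_symm _ _
  re_inner_nonneg u := by
    rw [graphInner_self]
    exact K.graphSq_nonneg _
  add_left u v z := by
    rw [← graphInner_conj_symm, map_add, graphInner_add_left, map_add, graphInner_conj_symm,
      graphInner_conj_symm]
  smul_left u z c := by
    rw [← graphInner_conj_symm, map_smul, graphInner_smul_left, map_mul, graphInner_conj_symm]
  definite u h := by
    rw [graphInner_self, Complex.ofReal_eq_zero] at h
    obtain ⟨m, M, hm, hM, hb⟩ := K.exists_graphSq_bounds
    have h1 := (hb θ (K.toHilb.symm u)).1
    rw [h] at h1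
    have h2 : ‖fn (K.toHilb.symm u)‖ ^ 2 + ‖der (K.toHilb.symm u)‖ ^ 2 ≤ 0 := by
      by_contra hcon
      push Not at hcon
      have := mul_pos hm hcon
      linarith
    have h3 : fn (K.toHilb.symm u) = 0 := norm_eq_zero.1 (by
      nlinarith [norm_nonneg (fn (K.toHilb.symm u)), sq_nonneg ‖der (K.toHilb.symm u)‖])
    have h4 : der (K.toHilb.symm u) = 0 := norm_eq_zero.1 (by
      nlinarith [norm_nonneg (der (K.toHilb.symm u)), sq_nonneg ‖fn (K.toHilb.symm u)‖])
    have h5 : K.toHilb.symm u = 0 := Subtype.ext (Prod.ext h3 h4)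
    simpa using h5

noncomputable instance : NormedAddCommGroup (K.Hilb θ) := (K.graphCore θ).toNormedAddCommGroup

noncomputable instance : InnerProductSpace ℂ (K.Hilb θ) :=
  InnerProductSpace.ofCore (K.graphCore θ).toCore

theorem inner_toHilb (u v : H1 θ) : inner ℂ (K.toHilb u) (K.toHilb v) = K.graphInner v u := rfl

theorem norm_toHilb (u : H1 θ) : ‖K.toHilb u‖ = K.graphNorm u := by
  rw [@norm_eq_sqrt_re_inner ℂ, inner_toHilb, graphInner_self]
  rfl

theorem norm_toHilb_sq (u : H1 θ) : ‖K.toHilb u‖ ^ 2 = K.graphSq u := by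
  rw [norm_toHilb, graphNorm_eq, Real.sq_sqrt (K.graphSq_nonneg u)]

/-- Completeness passes from the closed subspace `H1 θ` by norm equivalence; the factor 2 in `√(2 *
M)` compares a sum of two squares with the maximum norm. -/
instance : CompleteSpace (K.Hilb θ) := by
  obtain ⟨m, M, hm, hM, hb⟩ := K.exists_graphSq_bounds
  have hsup : ∀ u : H1 θ, ‖fn u‖ ≤ ‖u‖ ∧ ‖der u‖ ≤ ‖u‖ := fun u =>
    ⟨norm_fst_le u.1, norm_snd_le u.1⟩
  let e : H1 θ ≃L[ℂ] K.Hilb θ := K.toHilb.toContinuousLinearEquivOfBounds (√(2 * M)) (√m⁻¹)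
    (fun u => by
      refine (sq_le_sq₀ (norm_nonneg _) (by positivity)).1 ?_
      rw [norm_toHilb_sq, mul_pow, Real.sq_sqrt (by positivity)]
      have h1 : ‖fn u‖ ^ 2 ≤ ‖u‖ ^ 2 := by gcongr; exact (hsup u).1
      have h2 : ‖der u‖ ^ 2 ≤ ‖u‖ ^ 2 := by gcongr; exact (hsup u).2
      calc K.graphSq u ≤ M * (‖fn u‖ ^ 2 + ‖der u‖ ^ 2) := (hb θ u).2
        _ ≤ M * (‖u‖ ^ 2 + ‖u‖ ^ 2) := by gcongr
        _ = _ := by ring)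
    (fun v => by
      obtain ⟨u, rfl⟩ := K.toHilb.surjective v
      rw [LinearEquiv.symm_apply_apply]
      refine (sq_le_sq₀ (norm_nonneg _) (by positivity)).1 ?_
      rw [mul_pow, norm_toHilb_sq, Real.sq_sqrt (by positivity), inv_mul_eq_div, le_div_iff₀ hm]
      have h1 : ‖u‖ ^ 2 ≤ ‖fn u‖ ^ 2 + ‖der u‖ ^ 2 := by
        have h2 : ‖u‖ = max ‖fn u‖ ‖der u‖ := rfl
        rcases max_choice ‖fn u‖ ‖der u‖ with h3 | h3 <;> rw [h2, h3]
        · exact le_add_of_nonneg_right (by positivity)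
        · exact le_add_of_nonneg_left (by positivity)
      calc ‖u‖ ^ 2 * m ≤ (‖fn u‖ ^ 2 + ‖der u‖ ^ 2) * m := by gcongr
        _ = m * (‖fn u‖ ^ 2 + ‖der u‖ ^ 2) := mul_comm _ _
        _ ≤ _ := (hb θ u).1)
  exact (completeSpace_congr (e := e.toEquiv) e.isUniformEmbedding).1 inferInstance

end Cell

end HighContrast

/-! ### The operator of the stiff phase and the expansion -/

namespace HighContrast

namespace Cell

variable (K : Cell) {θ : ℝ}

theorem stiff_sq_le (u : H1 θ) : wsq K.a₁ (Ioo K.h 1) (der u) ≤ K.graphSq u := by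
  have h1 := K.adm_a₀.wsq_nonneg (der u)
  have h2 := K.adm_ρ.wsq_nonneg (fn u)
  rw [graphSq]
  linarith

theorem normρ_le (u : H1 θ) : K.normρ (fn u) ≤ K.graphNorm u := by
  have h1 := K.adm_a₀.wsq_nonneg (der u)
  have h2 := K.adm_a₁.wsq_nonneg (der u)
  rw [normρ_eq, graphNorm_eq, graphSq]
  exact Real.sqrt_le_sqrt (by linarith)

/-- The stiff form as a bounded sesquilinear form. -/
noncomputable def stiffForm (θ : ℝ) : K.Hilb θ →L⋆[ℂ] K.Hilb θ →L[ℂ] ℂ :=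
  LinearMap.mkContinuous₂
    (LinearMap.mk₂'ₛₗ (starRingEnd ℂ) (RingHom.id ℂ)
      (fun u v : K.Hilb θ => K.stiff (K.toHilb.symm v) (K.toHilb.symm u))
      (fun u u' v => by
        have h : der (K.toHilb.symm (u + u')) = der (K.toHilb.symm u) + der (K.toHilb.symm u') :=
          rfl
        simp only [stiff_eq, h]
        rw [← wform_conj_symm, K.adm_a₁.wform_add_left K.stiff_subset, map_add, wform_conj_symm,
          wform_conj_symm])
      (fun c u v => by
        have h : der (K.toHilb.symm (c • u)) = c • der (K.toHilb.symm u) := rfl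
        simp only [stiff_eq, h]
        rw [← wform_conj_symm, wform_smul_left K.stiff_subset, map_mul, wform_conj_symm,
          smul_eq_mul])
      (fun u v v' => by
        have h : der (K.toHilb.symm (v + v')) = der (K.toHilb.symm v) + der (K.toHilb.symm v') :=
          rfl
        simp only [stiff_eq, h]
        rw [K.adm_a₁.wform_add_left K.stiff_subset])
      (fun c u v => by
        have h : der (K.toHilb.symm (c • v)) = c • der (K.toHilb.symm v) := rfl
        simp only [stiff_eq, h]
        rw [wform_smul_left K.stiff_subset, RingHom.id_apply, smul_eq_mul])) 1 (fun u v => by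
    obtain ⟨u, rfl⟩ := K.toHilb.surjective u
    obtain ⟨v, rfl⟩ := K.toHilb.surjective v
    rw [LinearMap.mk₂'ₛₗ_apply, LinearEquiv.symm_apply_apply, LinearEquiv.symm_apply_apply,
      one_mul, stiff_eq, norm_toHilb, norm_toHilb, graphNorm_eq, graphNorm_eq, mul_comm]
    refine (K.adm_a₁.norm_wform_le K.stiff_subset _ _).trans ?_
    gcongr <;> exact K.stiff_sq_le _)

/-- The operator `A` with `⟪φ, A u⟫ = ∫_{Y₁} a₁ u' φ̄'`. -/
noncomputable def stiffOp (θ : ℝ) : K.Hilb θ →L[ℂ] K.Hilb θ :=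
  InnerProductSpace.continuousLinearMapOfBilin (K.stiffForm θ)

theorem stiffOp_inner (u v : H1 θ) :
    inner ℂ (K.stiffOp θ (K.toHilb u)) (K.toHilb v) = K.stiff v u := by
  rw [stiffOp, InnerProductSpace.continuousLinearMapOfBilin_apply]
  rfl

theorem inner_stiffOp (u v : H1 θ) :
    inner ℂ (K.toHilb v) (K.stiffOp θ (K.toHilb u)) = K.stiff u v := by
  rw [← inner_conj_symm, stiffOp_inner, stiff_eq, wform_conj_symm, stiff_eq]

theorem re_stiffOp_inner (u : H1 θ) :
    (inner ℂ (K.stiffOp θ (K.toHilb u)) (K.toHilb u)).re = wsq K.a₁ (Ioo K.h 1) (der u) := by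
  rw [stiffOp_inner, stiff_eq, wform_self, Complex.ofReal_re]

/-- The bound by one holds because the stiff energy is one of three nonnegative summands of the
squared graph norm. -/
theorem isPositiveContraction_stiffOp (θ : ℝ) : IsPositiveContraction (K.stiffOp θ) where
  symm x y := by
    obtain ⟨u, rfl⟩ := K.toHilb.surjective x
    obtain ⟨v, rfl⟩ := K.toHilb.surjective y
    rw [stiffOp_inner, inner_stiffOp]
  nonneg x := by
    obtain ⟨u, rfl⟩ := K.toHilb.surjective x
    rw [re_stiffOp_inner]
    exact K.adm_a₁.wsq_nonneg _
  le_one x := by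
    obtain ⟨u, rfl⟩ := K.toHilb.surjective x
    rw [re_stiffOp_inner, norm_toHilb_sq]
    exact K.stiff_sq_le u

theorem mem_V_iff (u : H1 θ) : u ∈ K.V θ ↔ K.toHilb u ∈ (K.stiffOp θ).ker := by
  rw [LinearMap.mem_ker, ContinuousLinearMap.coe_coe,
    (K.isPositiveContraction_stiffOp θ).apply_eq_zero_iff, re_stiffOp_inner,
    K.adm_a₁.wsq_eq_zero_iff K.stiff_subset]
  rfl

theorem mem_Vperp_iff (u : H1 θ) : u ∈ K.Vperp θ ↔ K.toHilb u ∈ (K.stiffOp θ).kerᗮ := by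
  rw [Submodule.mem_orthogonal]
  constructor
  · intro h v hv
    obtain ⟨v, rfl⟩ := K.toHilb.surjective v
    exact h v ((K.mem_V_iff v).2 hv)
  · intro h v hv
    exact h _ ((K.mem_V_iff v).1 hv)

/-- On `V_θ^⊥` the projection is the identity: `u - z` lies both in `V_θ` and in its complement. -/
theorem IsPoincareConstant.poincareBound {C : ℝ} (hC : K.IsPoincareConstant C)
    (hθ : θ ∈ Ico 0 (2 * Real.pi)) :
    IsPositiveContraction.PoincareBound (K.stiffOp θ) C := by
  refine ⟨hC.1, fun w hw => ?_⟩
  obtain ⟨u, rfl⟩ := K.toHilb.surjective w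
  obtain ⟨z, ⟨hz, huz⟩, hle⟩ := hC.2 θ hθ u
  have h1 : K.toHilb (u - z) ∈ (K.stiffOp θ).kerᗮ := by
    rw [map_sub]
    exact Submodule.sub_mem _ hw ((K.mem_Vperp_iff z).1 hz)
  have h2 : K.toHilb (u - z) = 0 := inner_self_eq_zero.1 (h1 _ ((K.mem_V_iff _).1 huz))
  have h3 : u = z := sub_eq_zero.1 (K.toHilb.map_eq_zero_iff.1 h2)
  rw [← h3, stiffNorm_eq] at hle
  rw [re_stiffOp_inner, norm_toHilb, ← Real.sq_sqrt (K.adm_a₁.wsq_nonneg (der u)), ← mul_pow]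
  gcongr
  exact Real.sqrt_nonneg _

/-- Every `u` can be modified by an element of `V_θ` so that its graph norm is controlled by the
stiff phase. -/
theorem exists_sub_mem_V : ∃ C : ℝ, 0 < C ∧ ∀ (θ : ℝ) (u : H1 θ),
    ∃ z : H1 θ, u - z ∈ K.V θ ∧ K.graphNorm z ≤ C * K.stiffNorm u := by
  obtain ⟨m, M, hm, hM, hb⟩ := K.exists_graphSq_bounds
  obtain ⟨m₁, M₁, hm₁, hM₁, h₁⟩ := K.adm_a₁.exists_wsq_bounds K.stiff_subset
  have hh := K.h_pos
  refine ⟨√(2 * M * (1 + K.h⁻¹) ^ 2 * m₁⁻¹), by positivity, fun θ u => ?_⟩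
  have hmem : MemLp ((Ioo K.h 1).indicator (der u)) 2 μY :=
    (Lp.memLp (der u)).indicator measurableSet_Ioo
  set k : L2Y := hmem.toLp with hk
  set χ : L2Y := indicatorConstLp 2 (measurableSet_Ioo (a := (0 : ℝ)) (b := K.h))
    (measure_ne_top μY _) (1 : ℂ) with hχ
  set I : ℂ := primAt 1 k with hI
  have hknorm : ‖k‖ ^ 2 = ∫ y in Ioo K.h 1, ‖der u y‖ ^ 2 := by
    rw [← integral_norm_sq_L2Y]
    have h1 : ∫ y in Ioo (0 : ℝ) 1, ‖k y‖ ^ 2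
        = ∫ y, (Ioo K.h 1).indicator (fun y => ‖der u y‖ ^ 2) y ∂μY := by
      refine integral_congr_ae ?_
      filter_upwards [hmem.coeFn_toLp] with y hy
      rw [hk, hy]
      by_cases hyS : y ∈ Ioo K.h 1
      · rw [indicator_of_mem hyS, indicator_of_mem hyS]
      · rw [indicator_of_notMem hyS, indicator_of_notMem hyS]; simp
    rw [h1, integral_indicator measurableSet_Ioo, Measure.restrict_restrict measurableSet_Ioo,
      inter_eq_left.2 K.stiff_subset]
  have hχnorm : ‖χ‖ ≤ 1 := by
    refine norm_indicatorConstLp_le.trans ?_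
    rw [norm_one, one_mul]
    exact Real.rpow_le_one measureReal_nonneg measureReal_le_one (by positivity)
  have hχI : primAt 1 χ = K.h := by
    rw [primAt_one, hχ, integral_indicatorConstLp, measureReal_restrict_apply measurableSet_Ioo,
      inter_eq_left.2 K.soft_subset, Real.volume_real_Ioo_of_le hh.le]
    simp
  -- On the stiff phase `g = u'`; on the soft phase it is the constant that cancels the mean `I`,
  -- whence the factor `1 + K.h⁻¹` below.
  set g : L2Y := k - (I / K.h) • χ with hg
  have hhne : (K.h : ℂ) ≠ 0 := by exact_mod_cast hh.ne'
  have hg0 : primAt 1 g = 0 := by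
    rw [hg, map_sub, map_smul, hχI, smul_eq_mul, div_mul_cancel₀ _ hhne, sub_self]
  have hgnorm : ‖g‖ ≤ (1 + K.h⁻¹) * ‖k‖ := by
    have hIle : ‖I / K.h‖ ≤ K.h⁻¹ * ‖k‖ := by
      rw [norm_div, Complex.norm_real, Real.norm_of_nonneg hh.le, div_eq_inv_mul]
      gcongr
      exact norm_primAt_le 1 k
    calc ‖g‖ ≤ ‖k‖ + ‖(I / K.h) • χ‖ := norm_sub_le _ _
      _ ≤ ‖k‖ + (K.h⁻¹ * ‖k‖) * 1 := by rw [norm_smul]; gcongr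
      _ = _ := by ring
  have hprim : ‖prim g‖ ≤ ‖g‖ := norm_prim_le g
  -- Zero at both ends, `prim g` satisfies the boundary condition for every `θ`, with a bound free
  -- of `θ`.
  let z : H1 θ := ⟨(prim g, g), mem_H1_iff.2 ⟨0, by simp, by simp [hg0]⟩⟩
  refine ⟨z, ?_, ?_⟩
  · have e1 : der (u - z) = der u - g := rfl
    change ∀ᵐ y ∂(volume.restrict (Ioo K.h (1 : ℝ))), der (u - z) y = 0
    rw [e1]
    have hχc : χ =ᵐ[μY] (Ioo 0 K.h).indicator fun _ => (1 : ℂ) := indicatorConstLp_coeFn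
    filter_upwards [ae_restrict_of_L2Y K.stiff_subset (Lp.coeFn_sub (der u) g),
      ae_restrict_of_L2Y K.stiff_subset (Lp.coeFn_sub k ((I / K.h) • χ)),
      ae_restrict_of_L2Y K.stiff_subset (Lp.coeFn_smul (I / K.h) χ),
      ae_restrict_of_L2Y K.stiff_subset hmem.coeFn_toLp,
      ae_restrict_of_L2Y K.stiff_subset hχc,
      ae_restrict_mem measurableSet_Ioo] with y e2 e3 e4 e5 e6 hy
    have hy' : y ∉ Ioo 0 K.h := fun h => lt_asymm h.2 hy.1
    rw [e2, Pi.sub_apply, e3, Pi.sub_apply, e4, Pi.smul_apply, e5, e6, indicator_of_mem hy,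
      indicator_of_notMem hy']
    simp
  · rw [graphNorm_eq, stiffNorm_eq, ← Real.sqrt_mul (by positivity)]
    refine Real.sqrt_le_sqrt ?_
    have e1 := (h₁ (der u)).1
    rw [← hknorm] at e1
    have e2 : ‖k‖ ^ 2 ≤ m₁⁻¹ * wsq K.a₁ (Ioo K.h 1) (der u) := by
      rw [inv_mul_eq_div, le_div_iff₀ hm₁, mul_comm]; exact e1
    calc K.graphSq z ≤ M * (‖prim g‖ ^ 2 + ‖g‖ ^ 2) := (hb θ z).2
      _ ≤ M * (‖g‖ ^ 2 + ‖g‖ ^ 2) := by gcongr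
      _ = 2 * M * ‖g‖ ^ 2 := by ring
      _ ≤ 2 * M * ((1 + K.h⁻¹) * ‖k‖) ^ 2 := by gcongr
      _ = 2 * M * (1 + K.h⁻¹) ^ 2 * ‖k‖ ^ 2 := by ring
      _ ≤ 2 * M * (1 + K.h⁻¹) ^ 2 * (m₁⁻¹ * wsq K.a₁ (Ioo K.h 1) (der u)) := by gcongr
      _ = _ := by ring

/-- The Poincaré-type inequality holds uniformly in `θ`. -/
theorem exists_isPoincareConstant : ∃ C : ℝ, K.IsPoincareConstant C := by
  obtain ⟨C, hC, h⟩ := K.exists_sub_mem_V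
  refine ⟨C, hC, fun θ _ u => ?_⟩
  have hcl : IsClosed ((K.stiffOp θ).ker : Set (K.Hilb θ)) := (K.stiffOp θ).isClosed_ker
  have : CompleteSpace (K.stiffOp θ).ker := hcl.completeSpace_coe
  obtain ⟨v, hv, w, hw, huv⟩ := (K.stiffOp θ).ker.exists_add_mem_mem_orthogonal (K.toHilb u)
  obtain ⟨v, rfl⟩ := K.toHilb.surjective v
  obtain ⟨w, rfl⟩ := K.toHilb.surjective w
  obtain ⟨z, hz, hle⟩ := h θ u
  rw [mem_V_iff, map_sub, huv] at hz
  refine ⟨w, ⟨(K.mem_Vperp_iff w).2 hw, ?_⟩, le_trans ?_ hle⟩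
  · rw [mem_V_iff, map_sub, huv, add_sub_cancel_right]
    exact hv
  · rw [← norm_toHilb, ← norm_toHilb]
    have h1 : K.toHilb z - K.toHilb w ∈ (K.stiffOp θ).ker := by
      have := Submodule.sub_mem _ hv hz
      convert this using 1
      abel
    -- Both `w` and `z` differ from `u` by elements of `V_θ`; Pythagoras then gives `‖w‖ ≤ ‖z‖`.
    have h2 : inner ℂ (K.toHilb w) (K.toHilb z - K.toHilb w) = 0 :=
      inner_eq_zero_symm.1 (hw _ h1)
    have h3 := norm_add_sq_eq_norm_sq_add_norm_sq_of_inner_eq_zero _ _ h2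
    rw [add_sub_cancel] at h3
    nlinarith [norm_nonneg (K.toHilb w), norm_nonneg (K.toHilb z),
      norm_nonneg (K.toHilb z - K.toHilb w)]

/-- The Riesz representative of `φ ↦ ∫_Y ρ f φ̄`. -/
theorem exists_source (θ : ℝ) (f : L2Y) : ∃ F : K.Hilb θ, ‖F‖ ≤ K.normρ f ∧
    ∀ φ : H1 θ, inner ℂ (K.toHilb φ) F = K.innerρ f (fn φ) := by
  let ℓ : K.Hilb θ →L[ℂ] ℂ := LinearMap.mkContinuous
    { toFun := fun φ => K.innerρ (fn (K.toHilb.symm φ)) f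
      map_add' := fun φ ψ => by
        have h : fn (K.toHilb.symm (φ + ψ)) = fn (K.toHilb.symm φ) + fn (K.toHilb.symm ψ) := rfl
        rw [h, innerρ_eq, K.adm_ρ.wform_add_left subset_rfl]
        rfl
      map_smul' := fun c φ => by
        have h : fn (K.toHilb.symm (c • φ)) = c • fn (K.toHilb.symm φ) := rfl
        rw [h, innerρ_eq, wform_smul_left subset_rfl]
        rfl } (K.normρ f) (fun φ => by
      obtain ⟨u, rfl⟩ := K.toHilb.surjective φ
      have h1 := K.adm_ρ.norm_wform_le subset_rfl (fn u) f
      have h2 := K.normρ_le u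
      rw [norm_toHilb, mul_comm]
      exact h1.trans (mul_le_mul_of_nonneg_right h2 (Real.sqrt_nonneg _)))
  refine ⟨(InnerProductSpace.toDual ℂ (K.Hilb θ)).symm ℓ, ?_, fun φ => ?_⟩
  · rw [LinearIsometryEquiv.norm_map]
    exact LinearMap.mkContinuous_norm_le _ (Real.sqrt_nonneg _) _
  · rw [← inner_conj_symm, InnerProductSpace.toDual_symm_apply, innerρ_eq, ← wform_conj_symm]
    rfl

/-- Removing the stiff part from the full graph inner product leaves the terms not scaled by `ε⁻²`.
-/
theorem inner_sub_stiffOp (u φ : H1 θ) :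
    inner ℂ (K.toHilb φ) (K.toHilb u - K.stiffOp θ (K.toHilb u))
      = K.soft u φ + K.innerρ (fn u) (fn φ) := by
  rw [inner_sub_right, inner_stiffOp, inner_toHilb, graphInner]
  ring

theorem eq_iff_forall_inner {x y : K.Hilb θ} :
    x = y ↔ ∀ φ : H1 θ, inner ℂ (K.toHilb φ) x = inner ℂ (K.toHilb φ) y := by
  refine ⟨fun h φ => by rw [h], fun h => ext_inner_left ℂ fun v => ?_⟩
  obtain ⟨v, rfl⟩ := K.toHilb.surjective v
  exact h v

/-! ### The three weak problems as operator equations. -/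

section Source

variable {f : L2Y} {F : K.Hilb θ}

theorem isLimitSolution_iff (hF : ∀ φ : H1 θ, inner ℂ (K.toHilb φ) F = K.innerρ f (fn φ))
    (u : H1 θ) : K.IsLimitSolution f u ↔
      K.stiffOp θ (K.toHilb u) = 0 ∧ F - K.toHilb u ∈ (K.stiffOp θ).kerᗮ := by
  rw [IsLimitSolution, K.mem_V_iff u]
  -- On `V_θ` the stiff term vanishes, so the weak equation says that `F - u` is orthogonal to
  -- `V_θ`.
  refine and_congr_right fun h0 => ?_
  replace h0 : K.stiffOp θ (K.toHilb u) = 0 := h0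
  have key : ∀ φ : H1 θ, inner ℂ (K.toHilb φ) (F - K.toHilb u)
      = K.innerρ f (fn φ) - (K.soft u φ + K.innerρ (fn u) (fn φ)) := by
    intro φ
    rw [← inner_sub_stiffOp, h0, sub_zero, inner_sub_right, hF]
  rw [Submodule.mem_orthogonal]
  constructor
  · intro h v hv
    obtain ⟨v, rfl⟩ := K.toHilb.surjective v
    rw [key, h v ((K.mem_V_iff v).2 hv), sub_self]
  · intro h v hv
    have h1 := h _ ((K.mem_V_iff v).1 hv)
    rw [key] at h1
    exact (sub_eq_zero.1 h1).symm

theorem isCorrector_iff (hF : ∀ φ : H1 θ, inner ℂ (K.toHilb φ) F = K.innerρ f (fn φ))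
    (n : ℕ) (u w : H1 θ) : K.IsCorrector f (n + 1) u w ↔
      K.toHilb w ∈ (K.stiffOp θ).kerᗮ ∧ K.stiffOp θ (K.toHilb w)
        = (if n = 0 then F else 0) - (K.toHilb u - K.stiffOp θ (K.toHilb u)) := by
  refine and_congr (K.mem_Vperp_iff w) ?_
  rw [eq_iff_forall_inner]
  refine forall_congr' fun φ => ?_
  rw [inner_stiffOp, inner_sub_right, inner_sub_stiffOp]
  by_cases hn : n = 0
  · simp only [hn, if_true, hF, zero_add]
    constructor <;> intro h <;> rw [h] <;> ring
  · simp only [hn, if_false, inner_zero_right, Nat.add_eq_right]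
    constructor <;> intro h <;> rw [h] <;> ring

theorem isResolventSolution_iff (hF : ∀ φ : H1 θ, inner ℂ (K.toHilb φ) F = K.innerρ f (fn φ))
    (ε : ℝ) (u : H1 θ) : K.IsResolventSolution ε f u ↔
      K.toHilb u - K.stiffOp θ (K.toHilb u)
        + (((ε ^ 2)⁻¹ : ℝ) : ℂ) • K.stiffOp θ (K.toHilb u) = F := by
  rw [eq_iff_forall_inner]
  refine forall_congr' fun φ => ?_
  rw [inner_add_right, inner_sub_stiffOp, inner_smul_right, inner_stiffOp, hF]
  constructor <;> intro h <;> rw [← h] <;> ring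

end Source

end Cell

end HighContrast

/-! ### Assembly of the operator results. -/

theorem theorem7p2 (K : HighContrast.Cell) :
    (∃ C : ℝ, K.IsPoincareConstant C) ∧
    ∀ θ ∈ Set.Ico 0 (2 * Real.pi), ∀ f : HighContrast.L2Y,
      ∃ u : ℕ → HighContrast.H1 θ,
        HighContrast.IsUnique (K.IsLimitSolution f) (u 0) ∧
        (∀ n : ℕ, 1 ≤ n → HighContrast.IsUnique (K.IsCorrector f n (u (n - 1))) (u n)) ∧
        ∀ ε ∈ Set.Ioo (0 : ℝ) 1,
          ∃ uε : HighContrast.H1 θ,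
            HighContrast.IsUnique (K.IsResolventSolution ε f) uε ∧
            ∀ C : ℝ, K.IsPoincareConstant C → ∀ N : ℕ,
              K.graphNorm (uε - ∑ n ∈ Finset.range (N + 1), ((ε : ℂ) ^ (2 * n)) • u n)
                ≤ C ^ (2 * (N + 1)) * ε ^ (2 * (N + 1)) * K.normρ f := by
  obtain ⟨C₀, hC₀⟩ := K.exists_isPoincareConstant
  refine ⟨⟨C₀, hC₀⟩, fun θ hθ f => ?_⟩
  have hA := K.isPositiveContraction_stiffOp θ
  obtain ⟨F, hFn, hF⟩ := K.exists_source θ f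
  -- The constant `C₀` serves only for solvability; the terms are fixed before any `C`, and the
  -- estimate then holds for every admissible `C`.
  obtain ⟨U, hU0, hUF, hU⟩ := hA.exists_expansion (hC₀.poincareBound K hθ) F
  have hsymm : ∀ n, K.toHilb (K.toHilb.symm (U n)) = U n := fun n =>
    K.toHilb.apply_symm_apply (U n)
  refine ⟨fun n => K.toHilb.symm (U n), ⟨?_, fun w hw => ?_⟩, fun n hn => ?_, fun ε hε => ?_⟩
  · rw [K.isLimitSolution_iff hF, hsymm]
    exact ⟨hU0, hUF⟩
  · rw [K.isLimitSolution_iff hF] at hw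
    apply K.toHilb.injective
    rw [hsymm, ← sub_eq_zero]
    have h1 : K.toHilb w - U 0 ∈ (K.stiffOp θ).ker := Submodule.sub_mem _ hw.1 hU0
    have h2 : K.toHilb w - U 0 ∈ (K.stiffOp θ).kerᗮ := by
      have := Submodule.sub_mem _ hUF hw.2
      convert this using 1
      abel
    exact inner_self_eq_zero.1 (h2 _ h1)
  · obtain ⟨n, rfl⟩ := Nat.exists_eq_add_of_le' hn
    rw [Nat.add_sub_cancel]
    refine ⟨?_, fun w hw => ?_⟩
    · rw [K.isCorrector_iff hF, hsymm, hsymm]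
      exact hU n
    · rw [K.isCorrector_iff hF, hsymm] at hw
      apply K.toHilb.injective
      rw [hsymm]
      exact HighContrast.IsPositiveContraction.eq_of_apply_eq hw.1 (hU n).1
        (hw.2.trans (hU n).2.symm)
  · obtain ⟨x, hx⟩ := hA.exists_resolvent hε F
    obtain ⟨v, rfl⟩ := K.toHilb.surjective x
    refine ⟨v, ⟨(K.isResolventSolution_iff hF ε v).2 hx, fun w hw => ?_⟩, fun C hC N => ?_⟩
    · rw [K.isResolventSolution_iff hF] at hw
      exact K.toHilb.injective (hA.eq_of_resolvent hε (hw.trans hx.symm))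
    · have h1 := hA.norm_resolvent_sub_expansion_le (hC.poincareBound K hθ) hU0 hU hε hx N
      rw [← K.norm_toHilb, map_sub, map_sum]
      simp only [map_smul, hsymm]
      refine h1.trans ?_
      have := hC.1
      have := hε.1
      gcongr
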